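/- **Setting.** Let $\hat\rho$ be an $n$-mode state (a positive trace-class operator of trace one on the Hilbert space $L^2(\mathbb R^n)$ of $n$ bosonic modes), let $\hat D(\alpha)=\bigotimes_{i=1}^n e^{\alpha_i\hat a_i^\dagger-\alpha_i^*\hat a_i}$, $\alpha\in\mathbb C^n$, be the displacement operators, and let $\chi_{\hat\rho}(\alpha)=\mathrm{Tr}[\hat\rho\hat D(\alpha)]$ be the characteristic function. For $s\in[-1,1]$ the $s$-ordered quasiprobability distribution is the generalized function $$W_{\hat\rho}(s,\beta)=\frac1{\pi^{2n}}\int d^{2n}\alpha\; e^{s|\alpha|^2/2}\chi_{\hat\rho}(\alpha)\,e^{\alpha^\dagger\beta-\beta^\dagger\alpha},$$ understood through its pairing with Schwartz functions whose Fourier transform has compact support. The classicality $s_{\max}(\hat\rho)$ is the largest $s\in[-1,1]$ with $W_{\hat\rho}(s,\cdot)\ge 0$, and $\hat\rho$ is classical if $W_{\hat\rho}(1,\cdot)\ge0$. A heterodyne measurement of $\hat\rho$ returns $\zeta\in\mathbb C^n$ with probability density $\langle\zeta|\hat\rho|\zeta\rangle/\pi^n$, where $|\zeta\rangle=\hat D(\zeta)|0\rangle$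 is the coherent state. For $\epsilon\in(0,1)$ and $s\in(0,1]$ put $L_\epsilon(s)=\frac2s\log(1/\epsilon)$. The heterodyne scheme with parameters $\epsilon,s$ measures each of $N$ copies of $\hat\rho$ separately by heterodyne detection, obtaining independent outcomes $\zeta_1,\dots,\zeta_N$, and then answers a query $\alpha\in\mathbb C^n$ by $$\hat u(\alpha)=\begin{cases} e^{|\alpha|^2/2}\,\frac1N\sum_{j=1}^N e^{\zeta_j^\dagger\alpha-\alpha^\dagger\zeta_j}, & |\alpha|^2\le L_\epsilon(s),\\ 0,& |\alpha|^2>L_\epsilon(s).\end{cases}$$ **Theorem.** For every $c>1$ there is a constant $C>0$, depending only on $c$, with the following property. Let $n\ge0$ and $M$ be integers, $\epsilon,\delta\in(0,1)$ and $\kappa>0$, with $M\ge c\,\delta$ (for $c=2$ this holds for every $\delta\in(0,1)$ if $M\ge2$, and for every $\delta\le 1/2$ if $M=1$). Let $\hat\rho$ be an $n$-mode state, and let $\alpha_1,\dots,\alpha_M\in\mathbb C^n$ satisfy $|\alpha_i|^2\le\kappa n$. The heterodyne density $\langle\zeta|\hat\rho|\zeta\rangle/\pi^n$ is a probability density, and: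 1. If $s_{\max}\in(0,1]$ and $\hat\rho$ has classicality at least $s_{\max}$, then the heterodyne scheme with parameters $\epsilon,s_{\max}$ satisfies $$\Pr\bigl[\,|\hat u(\alpha_i)-\chi_{\hat\rho}(\alpha_i)|\le\epsilon\ \text{ for all } i=1,\dots,M\,\bigr]\ \ge\ 1-\delta$$ for every number of copies $N$ with $$N\ \ge\ \begin{cases} C\,\epsilon^{-2}e^{\kappa n}\log(M/\delta), & \text{if }\kappa n\le L_\epsilon(s_{\max}),\\ C\,\epsilon^{-2(1+1/s_{\max})}\log(M/\delta), & \text{if }\kappa n\ge L_\epsilon(s_{\max}).\end{cases}$$ 2. If $\hat\rho$ is classical, then the heterodyne scheme with parameters $\epsilon,1$ has the same guarantee for every $N\ge C\,\epsilon^{-4}\log(M/\delta)$. -/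

import Mathlib

open MeasureTheory

noncomputable section

namespace CVLearning

/-- The phase space `ℂⁿ` of an `n`-mode system, with the Euclidean norm `|α|² = ∑ i, |α i|²`.
Its `volume` is Lebesgue measure `d²ⁿα = ∏ i, d(Re α i) d(Im α i)`, and
`inner ℂ ζ α = ∑ i, conj (ζ i) * α i = ζ†α`. -/
abbrev PhaseSpace (n : ℕ) : Type := EuclideanSpace ℂ (Fin n)

/-- The Hilbert space `L²(ℝⁿ)` of an `n`-mode bosonic system. The position operators act by
multiplication by `x i`, the momentum operators by `-i ∂/∂x i`, and the annihilation operators are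
`a i = (x i + ∂/∂x i) / √2`. -/
abbrev ModeSpace (n : ℕ) : Type :=
  Lp ℂ 2 (volume : Measure (EuclideanSpace ℝ (Fin n)))

/-- The position shift `q = √2 Re α` of a displacement. -/
def posShift {n : ℕ} (α : PhaseSpace n) : EuclideanSpace ℝ (Fin n) :=
  WithLp.toLp 2 fun i => √2 * (α i).re

/-- The momentum shift `p = √2 Im α` of a displacement. -/
def momShift {n : ℕ} (α : PhaseSpace n) : EuclideanSpace ℝ (Fin n) :=
  WithLp.toLp 2 fun i => √2 * (α i).im

/-- The phase `e^{i (p·x - q·p / 2)}` of a displacement in the position representation. -/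
def dispPhase {n : ℕ} (α : PhaseSpace n) (x : EuclideanSpace ℝ (Fin n)) : ℂ :=
  Complex.exp (((inner ℝ (momShift α) x - inner ℝ (posShift α) (momShift α) / 2 : ℝ) : ℂ)
    * Complex.I)

theorem norm_dispPhase {n : ℕ} (α : PhaseSpace n) (x : EuclideanSpace ℝ (Fin n)) :
    ‖dispPhase α x‖ = 1 :=
  Complex.norm_exp_ofReal_mul_I _

theorem continuous_dispPhase {n : ℕ} (α : PhaseSpace n) : Continuous (dispPhase α) := by
  unfold dispPhase
  fun_prop

/-- Translation `ψ ↦ ψ(· - q)` on `L²(ℝⁿ)`. -/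
def translate {n : ℕ} (q : EuclideanSpace ℝ (Fin n)) : ModeSpace n →ₗᵢ[ℂ] ModeSpace n :=
  Lp.compMeasurePreservingₗᵢ ℂ (fun x => x - q) (measurePreserving_sub_right volume q)

theorem memLp_dispPhase_mul {n : ℕ} (α : PhaseSpace n) (ψ : ModeSpace n) :
    MemLp (fun x => dispPhase α x * ψ x) 2 volume := by
  refine (Lp.memLp ψ).of_le
    ((continuous_dispPhase α).aestronglyMeasurable.mul (Lp.aestronglyMeasurable ψ)) ?_
  filter_upwards with x
  simp [norm_dispPhase]

/-- Multiplication by the phase of a displacement, as an isometry of `L²(ℝⁿ)`. -/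
def modulate {n : ℕ} (α : PhaseSpace n) : ModeSpace n →ₗᵢ[ℂ] ModeSpace n where
  toFun ψ := (memLp_dispPhase_mul α ψ).toLp _
  map_add' ψ φ := by
    refine Lp.ext ?_
    filter_upwards [(memLp_dispPhase_mul α (ψ + φ)).coeFn_toLp,
      Lp.coeFn_add ((memLp_dispPhase_mul α ψ).toLp _) ((memLp_dispPhase_mul α φ).toLp _),
      (memLp_dispPhase_mul α ψ).coeFn_toLp, (memLp_dispPhase_mul α φ).coeFn_toLp,
      Lp.coeFn_add ψ φ] with x h1 h2 h3 h4 h5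
    rw [h1, h2, Pi.add_apply, h3, h4, h5, Pi.add_apply, mul_add]
  map_smul' c ψ := by
    refine Lp.ext ?_
    filter_upwards [(memLp_dispPhase_mul α (c • ψ)).coeFn_toLp,
      Lp.coeFn_smul c ((memLp_dispPhase_mul α ψ).toLp _),
      (memLp_dispPhase_mul α ψ).coeFn_toLp, Lp.coeFn_smul c ψ] with x h1 h2 h3 h4
    rw [RingHom.id_apply, h1, h2, Pi.smul_apply, h3, h4, Pi.smul_apply]
    simp only [smul_eq_mul]
    ring
  norm_map' ψ := by
    change ‖(memLp_dispPhase_mul α ψ).toLp _‖ = ‖ψ‖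
    rw [Lp.norm_toLp, Lp.norm_def]
    congr 1
    refine eLpNorm_congr_norm_ae ?_
    filter_upwards with x
    simp [norm_dispPhase]

/-- The displacement operator `D(α) = ⊗ i, exp(α i a i† - conj (α i) a i)`. With `q = √2 Re α` and
`p = √2 Im α` the exponent is `i (p·x̂ - q·p̂)`, so that
`(D(α) ψ)(x) = e^{i (p·x - q·p / 2)} ψ(x - q)`. -/
def displacement {n : ℕ} (α : PhaseSpace n) : ModeSpace n →L[ℂ] ModeSpace n :=
  ((modulate α).comp (translate (posShift α))).toContinuousLinearMap

theorem displacement_ae {n : ℕ} (α : PhaseSpace n) (ψ : ModeSpace n) :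
    (displacement α ψ : EuclideanSpace ℝ (Fin n) → ℂ) =ᵐ[volume]
      fun x => dispPhase α x * ψ (x - posShift α) := by
  have h1 := (memLp_dispPhase_mul α (translate (posShift α) ψ)).coeFn_toLp
  have h2 := Lp.coeFn_compMeasurePreserving ψ
    (measurePreserving_sub_right (volume : Measure (EuclideanSpace ℝ (Fin n))) (posShift α))
  filter_upwards [h1, h2] with x hx1 hx2
  exact hx1.trans (congrArg (dispPhase α x * ·) hx2)

/-- The vacuum wave function `π^{-n/4} e^{-|x|²/2}`. -/
def vacuumFun (n : ℕ) (x : EuclideanSpace ℝ (Fin n)) : ℂ :=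
  ((Real.pi ^ (-(n : ℝ) / 4) * Real.exp (-‖x‖ ^ 2 / 2) : ℝ) : ℂ)

theorem memLp_vacuumFun (n : ℕ) : MemLp (vacuumFun n) 2 volume := by
  have hc : Continuous (vacuumFun n) := by
    unfold vacuumFun
    fun_prop
  rw [memLp_two_iff_integrable_sq_norm hc.aestronglyMeasurable]
  have h := (GaussianFourier.integrable_cexp_neg_mul_sq_norm_add
    (V := EuclideanSpace ℝ (Fin n)) (b := 1) (by simp) 0 0).norm
  refine (h.const_mul ((Real.pi ^ (-(n : ℝ) / 4)) ^ 2)).congr ?_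
  filter_upwards with x
  simp only [vacuumFun, Complex.norm_real, Real.norm_eq_abs, sq_abs, mul_pow, Complex.norm_exp]
  congr 1
  rw [← Real.exp_nat_mul]
  congr 1
  simp [← Complex.ofReal_pow]
  ring

/-- The vacuum state vector `|0⟩`. -/
def vacuum (n : ℕ) : ModeSpace n := (memLp_vacuumFun n).toLp _

/-- The coherent state vector `|ζ⟩ = D(ζ)|0⟩`. -/
def coherent {n : ℕ} (ζ : PhaseSpace n) : ModeSpace n := displacement ζ (vacuum n)

/-- The index set of a Hilbert basis of `L²(ℝⁿ)`. -/
def basisIndex (n : ℕ) : Set (ModeSpace n) :=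
  (exists_hilbertBasis ℂ (ModeSpace n)).choose

/-- A fixed Hilbert basis of `L²(ℝⁿ)`. The trace of a trace-class operator does not depend on
this choice. -/
def basis (n : ℕ) : HilbertBasis (basisIndex n) ℂ (ModeSpace n) :=
  (exists_hilbertBasis ℂ (ModeSpace n)).choose_spec.choose

/-- The trace `Tr T = ∑ i, ⟨e i, T e i⟩` of a (trace-class) operator. -/
def opTrace {n : ℕ} (T : ModeSpace n →L[ℂ] ModeSpace n) : ℂ :=
  ∑' i, inner ℂ (basis n i) (T (basis n i))

/-- An `n`-mode quantum state: a positive trace-class operator of trace one. -/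
structure QState (n : ℕ) where
  /-- The density operator. -/
  op : ModeSpace n →L[ℂ] ModeSpace n
  isPositive : op.IsPositive
  hasSum_trace : HasSum (fun i => inner ℂ (basis n i) (op (basis n i))) 1

namespace QState

variable {n : ℕ}

/-- The characteristic function `χ_ρ(α) = Tr[ρ D(α)]`. -/
def chi (ρ : QState n) (α : PhaseSpace n) : ℂ := opTrace (ρ.op ∘L displacement α)

/-- The `s`-ordered characteristic function `χ_ρ(s, α) = e^{s|α|²/2} χ_ρ(α)`. -/
def chiOrdered (ρ : QState n) (s : ℝ) (α : PhaseSpace n) : ℂ :=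
  Real.exp (s * ‖α‖ ^ 2 / 2) * ρ.chi α

end QState

/-- The Fourier transform `α ↦ π^{-2n} ∫ d²ⁿβ φ(β) e^{α†β - β†α}` of a function on phase space. -/
def phaseFourier {n : ℕ} (φ : PhaseSpace n → ℝ) (α : PhaseSpace n) : ℂ :=
  ((Real.pi ^ (2 * n))⁻¹ : ℝ) *
    ∫ β : PhaseSpace n, (φ β : ℂ) * Complex.exp (inner ℂ α β - inner ℂ β α)

namespace QState

variable {n : ℕ}

/-- The `s`-ordered quasiprobability distribution
`W_ρ(s, β) = π^{-2n} ∫ d²ⁿα χ_ρ(s, α) e^{α†β - β†α}`, which can be singular, as a generalized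
function: its pairing `∫ d²ⁿβ W_ρ(s, β) φ(β)` with a test function `φ`. Since `χ_ρ(s, ·)` may grow
like a Gaussian for `s > 0`, the test functions are the Schwartz functions with compactly supported
Fourier transform. -/
def qpd (ρ : QState n) (s : ℝ) (φ : SchwartzMap (PhaseSpace n) ℝ) : ℂ :=
  ∫ α : PhaseSpace n, ρ.chiOrdered s α * phaseFourier φ α

/-- `W_ρ(s, ·) ≥ 0`, in the sense of generalized functions: the pairing with every non-negative
test function is non-negative (it is always real on real test functions). A non-negative
generalized function is a measure, hence no more singular than a delta function. -/
def QPDNonneg (ρ : QState n) (s : ℝ) : Prop :=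
  ∀ φ : SchwartzMap (PhaseSpace n) ℝ, HasCompactSupport (phaseFourier φ) →
    (∀ β, 0 ≤ φ β) → 0 ≤ (ρ.qpd s φ).re

/-- The classicality parameter `s_max`: the largest `s ∈ [-1, 1]` with `W_ρ(s, ·) ≥ 0`. -/
def classicality (ρ : QState n) : ℝ :=
  sSup {s : ℝ | s ∈ Set.Icc (-1) 1 ∧ ρ.QPDNonneg s}

/-- A state is classical if its Glauber-Sudarshan function `P_ρ = W_ρ(1, ·)` is non-negative. -/
def IsClassical (ρ : QState n) : Prop := ρ.QPDNonneg 1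

/-- The law of the outcome `ζ` of a heterodyne measurement of `ρ`, i.e. of the POVM
`|ζ⟩⟨ζ| / πⁿ d²ⁿζ`: its density is `⟨ζ|ρ|ζ⟩ / πⁿ`. -/
def heterodyneLaw (ρ : QState n) : Measure (PhaseSpace n) :=
  volume.withDensity fun ζ =>
    ENNReal.ofReal ((inner ℂ (coherent ζ) (ρ.op (coherent ζ))).re / Real.pi ^ n)

end QState

/-- The truncation radius `L_ε(s) = (2 / s) log(1 / ε)` (for `|α|²`). -/
def truncRadius (ε s : ℝ) : ℝ := 2 / s * Real.log ε⁻¹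

open Classical in
/-- The estimate of `χ_ρ(α)` that the heterodyne scheme computes from the outcomes
`ζ 0, …, ζ (N - 1)`, given the accuracy `ε` and the promised classicality `s`:
`e^{|α|²/2} N⁻¹ ∑ j, e^{ζ_j†α - α†ζ_j}` if `|α|² ≤ L_ε(s)`, and `0` otherwise. -/
def heterodyneEstimate {n N : ℕ} (ε s : ℝ) (ζ : Fin N → PhaseSpace n) (α : PhaseSpace n) : ℂ :=
  if ‖α‖ ^ 2 ≤ truncRadius ε s then
    Real.exp (‖α‖ ^ 2 / 2) * ((N : ℂ)⁻¹ * ∑ j, Complex.exp (inner ℂ (ζ j) α - inner ℂ α (ζ j)))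
  else 0

/-- The probability that, when each of `N` copies of `ρ` is measured separately by heterodyne
detection, the resulting estimates are `ε`-accurate at all the query points `α i`. -/
def heterodyneSuccess {n M : ℕ} (ρ : QState n) (N : ℕ) (ε s : ℝ)
    (α : Fin M → PhaseSpace n) : ℝ :=
  (Measure.pi fun _ : Fin N => ρ.heterodyneLaw).real
    {ζ | ∀ i, ‖heterodyneEstimate ε s ζ (α i) - ρ.chi (α i)‖ ≤ ε}

end CVLearning

end

/-! The heterodyne density is the Husimi function of the state, and its Fourier transform is
`e^{-|α|²/2} χ_ρ(α)` (`integral_heterodyneLaw`). Hence `e^{|α|²/2} e^{ζ†α - α†ζ}` is an unbiased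
estimator of `χ_ρ(α)` of modulus `e^{|α|²/2}`, and Hoeffding's inequality
(`pi_real_norm_mean_sub_integral_gt_le`) with a union bound over the queries asks for about `ε⁻²
e^{|α|²} log(M/δ)` copies.

This cost grows with `|α|`, and classicality caps it. If `W_ρ(s, ·) ≥ 0`, then `e^{s|α|²/2} χ_ρ(α)`
is the Fourier transform of a positive object, so its modulus is at most its value 1 at the origin
(`QPDNonneg.norm_chiOrdered_le`). Therefore `|χ_ρ(α)| ≤ e^{-s|α|²/2} ≤ ε` beyond the truncation
radius `L`, where the answer 0 is correct with certainty. Only queries with `|α|² ≤ min(κn, L)` need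
data, and `e^L = ε^{-2/s}` (`exp_truncRadius`). A classical state is the case `s = 1`.

For the Fourier identity, the state is split into pure pieces `v k`. The overlap of `v k` with a
coherent state is, up to a phase, a short-time Fourier transform with Gaussian window. Plancherel in
the momentum and a Gaussian integral in the position then give `⟨v k, D(α) v k⟩` times the damping
factor (`integral_phase_mul_stft`). -/

open MeasureTheory

noncomputable section

namespace CVLearning

/-! ### Plancherel's theorem on `L¹ ∩ L²` -/

section

section Plancherel

open scoped FourierTransform ContDiff

variable {E : Type*} [NormedAddCommGroup E] [InnerProductSpace ℝ E] [FiniteDimensional ℝ E]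
  [MeasurableSpace E] [BorelSpace E]

/-- On `L¹ ∩ L²` the Fourier transform of `L²` agrees with the Fourier integral. -/
theorem fourier_toLp_ae {h : E → ℂ} (h1 : Integrable h) (h2 : MemLp h 2) :
    (𝓕 (h2.toLp h) : Lp ℂ 2 (volume : Measure E)) =ᵐ[volume] 𝓕 h := by
  have hl : LocallyIntegrable (𝓕 (h2.toLp h) : Lp ℂ 2 (volume : Measure E)) volume :=
    (Lp.memLp _).locallyIntegrable (by norm_num)
  have hc : Continuous (𝓕 h) :=
    VectorFourier.fourierIntegral_continuous Real.continuous_fourierChar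
      (by exact continuous_inner) h1
  -- It suffices to test against smooth compactly supported `g`. On the left the distributional
  -- Fourier transform, on the right the multiplication formula, moves the transform onto `g`.
  refine ae_eq_of_integral_contDiff_smul_eq hl hc.locallyIntegrable fun g hg hgc => ?_
  have hgc' : HasCompactSupport (fun x => (g x : ℂ)) := hgc.comp_left (g := Complex.ofReal) rfl
  have hg' : ContDiff ℝ ∞ (fun x => (g x : ℂ)) := Complex.ofRealCLM.contDiff.comp hg
  set φ : SchwartzMap E ℂ := hgc'.toSchwartzMap hg' with hφ
  have hφg : ∀ x, φ x = (g x : ℂ) := fun x => rfl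
  have e1 : ∫ x, g x • (𝓕 (h2.toLp h) : Lp ℂ 2 (volume : Measure E)) x
      = ∫ x, (𝓕 φ) x • h x := by
    have := congrArg (fun T : TemperedDistribution E ℂ => T φ)
      (Lp.fourier_toTemperedDistribution_eq (h2.toLp h))
    simp only [TemperedDistribution.fourier_apply, Lp.toTemperedDistribution_apply, hφg] at this
    simp only [Complex.real_smul, smul_eq_mul] at this ⊢
    rw [← this]
    refine integral_congr_ae ?_
    filter_upwards [h2.coeFn_toLp] with x hx
    rw [hx]
  rw [e1]
  have e2 := VectorFourier.integral_fourierIntegral_smul_eq_flip (e := Real.fourierChar)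
    (μ := (volume : Measure E)) (ν := (volume : Measure E)) (L := innerₗ E)
    (f := fun x => (g x : ℂ)) (g := h) Real.continuous_fourierChar
    (by exact continuous_inner) (φ.integrable) h1
  rw [flip_innerₗ] at e2
  simp only [SchwartzMap.fourier_coe]
  simp only [Complex.real_smul]
  exact e2

theorem memLp_fourier {h : E → ℂ} (h1 : Integrable h) (h2 : MemLp h 2) : MemLp (𝓕 h) 2 :=
  (memLp_congr_ae (fourier_toLp_ae h1 h2)).1 (Lp.memLp _)

/-- Plancherel's theorem on `L¹ ∩ L²`. -/
theorem integral_inner_fourier_of_memLp {h k : E → ℂ} (h1 : Integrable h) (h2 : MemLp h 2)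
    (k1 : Integrable k) (k2 : MemLp k 2) :
    ∫ w, inner ℂ (𝓕 h w) (𝓕 k w) = ∫ x, inner ℂ (h x) (k x) := by
  have := Lp.inner_fourier_eq (h2.toLp h) (k2.toLp k)
  rw [L2.inner_def, L2.inner_def] at this
  refine (integral_congr_ae ?_).trans (this.trans (integral_congr_ae ?_))
  · filter_upwards [fourier_toLp_ae h1 h2, fourier_toLp_ae k1 k2] with x hx kx
    rw [hx, kx]
  · filter_upwards [h2.coeFn_toLp, k2.coeFn_toLp] with x hx kx
    rw [hx, kx]

theorem fourier_comp_sub (h : E → ℂ) (a w : E) :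
    𝓕 (fun x => h (x - a)) w
      = Complex.exp (((-(2 * Real.pi * inner ℝ w a) : ℝ) : ℂ) * Complex.I) * 𝓕 h w := by
  have := congrFun (VectorFourier.fourierIntegral_comp_add_right Real.fourierChar
    (volume : Measure E) (innerₗ E) h (-a)) w
  simp only [Function.comp_def, ← sub_eq_add_neg] at this
  refine this.trans ?_
  rw [Circle.smul_def, Real.fourierChar_apply, smul_eq_mul]
  simp only [innerₗ_apply_apply, inner_neg_left, real_inner_comm]
  congr 3
  push_cast
  ring

end Plancherel

end

/-! ### Short-time Fourier transform with the vacuum as window -/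

section

open scoped FourierTransform ComplexConjugate

variable {n : ℕ}

theorem continuous_vacuumFun (n : ℕ) : Continuous (vacuumFun n) := by
  unfold vacuumFun
  fun_prop

/-- The windowed wave function `x ↦ g(x - q) v(x)`, with `g` the vacuum. -/
def windowed (v : ModeSpace n) (q x : EuclideanSpace ℝ (Fin n)) : ℂ := vacuumFun n (x - q) * v x

/-- The short-time Fourier transform of `v` with the vacuum as window. -/
def stft (v : ModeSpace n) (z : EuclideanSpace ℝ (Fin n) × EuclideanSpace ℝ (Fin n)) : ℂ :=
  𝓕 (windowed v z.1) z.2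

theorem conj_vacuumFun (x : EuclideanSpace ℝ (Fin n)) : conj (vacuumFun n x) = vacuumFun n x :=
  Complex.conj_ofReal _

theorem norm_vacuumFun_le (x : EuclideanSpace ℝ (Fin n)) :
    ‖vacuumFun n x‖ ≤ Real.pi ^ (-(n : ℝ) / 4) := by
  rw [vacuumFun, Complex.norm_real, Real.norm_of_nonneg (by positivity)]
  refine mul_le_of_le_one_right (by positivity) (Real.exp_le_one_iff.2 ?_)
  have := sq_nonneg ‖x‖
  linarith

theorem memLp_windowed (v : ModeSpace n) (q : EuclideanSpace ℝ (Fin n)) :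
    MemLp (windowed v q) 2 := by
  refine (Lp.memLp v).of_le_mul (c := Real.pi ^ (-(n : ℝ) / 4))
    (((continuous_vacuumFun n).comp (by fun_prop)).aestronglyMeasurable.mul
      (Lp.aestronglyMeasurable v)) ?_
  filter_upwards with x
  rw [windowed, norm_mul]
  exact mul_le_mul_of_nonneg_right (norm_vacuumFun_le _) (norm_nonneg _)

theorem memLp_vacuumFun_sub (q : EuclideanSpace ℝ (Fin n)) :
    MemLp (fun x => vacuumFun n (x - q)) 2 :=
  (memLp_vacuumFun n).comp_measurePreserving (measurePreserving_sub_right volume q)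

theorem integrable_windowed (v : ModeSpace n) (q : EuclideanSpace ℝ (Fin n)) :
    Integrable (windowed v q) :=
  (memLp_vacuumFun_sub q).integrable_mul (Lp.memLp v)

theorem stronglyMeasurable_stft (v : ModeSpace n) : StronglyMeasurable (stft v) := by
  have h1 : StronglyMeasurable (fun y : (EuclideanSpace ℝ (Fin n) × EuclideanSpace ℝ (Fin n)) ×
      EuclideanSpace ℝ (Fin n) =>
        Complex.exp (((-2 * Real.pi * inner ℝ y.2 y.1.2 : ℝ) : ℂ) * Complex.I)) :=
    Continuous.stronglyMeasurable (by fun_prop)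
  have h2 : StronglyMeasurable (fun y : (EuclideanSpace ℝ (Fin n) × EuclideanSpace ℝ (Fin n)) ×
      EuclideanSpace ℝ (Fin n) => vacuumFun n (y.2 - y.1.1)) :=
    ((continuous_vacuumFun n).comp (by fun_prop)).stronglyMeasurable
  have h3 : StronglyMeasurable (fun y : (EuclideanSpace ℝ (Fin n) × EuclideanSpace ℝ (Fin n)) ×
      EuclideanSpace ℝ (Fin n) => v y.2) :=
    (Lp.stronglyMeasurable v).comp_measurable measurable_snd
  have h := (h1.mul (h2.mul h3)).integral_prod_right' (ν := volume)
  convert h using 1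
  ext z
  rw [stft, Real.fourier_eq']
  rfl

/-- The constant phase of the displacement drops out in modulus. The factor `(2π)⁻¹` converts
momentum to the frequency of the `2π` convention. -/
theorem norm_inner_coherent (ζ : PhaseSpace n) (v : ModeSpace n) :
    ‖inner ℂ (coherent ζ) v‖ = ‖stft v (posShift ζ, (2 * Real.pi)⁻¹ • momShift ζ)‖ := by
  have e : inner ℂ (coherent ζ) v
      = Complex.exp (((inner ℝ (posShift ζ) (momShift ζ) / 2 : ℝ) : ℂ) * Complex.I) *
        stft v (posShift ζ, (2 * Real.pi)⁻¹ • momShift ζ) := by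
    rw [L2.inner_def, stft, Real.fourier_eq', ← integral_const_mul]
    refine integral_congr_ae ?_
    have h2 := (measurePreserving_sub_right (volume : Measure (EuclideanSpace ℝ (Fin n)))
      (posShift ζ)).quasiMeasurePreserving.ae (memLp_vacuumFun n).coeFn_toLp
    filter_upwards [displacement_ae ζ (vacuum n), h2] with x hx hx2
    rw [coherent, hx, vacuum, hx2, RCLike.inner_apply, map_mul, conj_vacuumFun, dispPhase,
      ← Complex.exp_conj, windowed, smul_eq_mul]
    simp only [map_mul, Complex.conj_ofReal, Complex.conj_I]
    have : ∀ A B C D G V : ℂ, A = B + C → V * (Complex.exp A * G)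
        = Complex.exp B * (Complex.exp C * (G * V)) := by
      intro A B C D G V h
      rw [h, Complex.exp_add]; ring
    refine this _ _ _ 0 _ _ ?_
    rw [inner_smul_right, real_inner_comm x]
    push_cast
    field_simp
    ring
  rw [e, norm_mul, Complex.norm_exp_ofReal_mul_I, one_mul]

/-- Plancherel in the frequency alone: the phase is the Fourier image of translation by `a`. -/
theorem integral_inner_stft (v : ModeSpace n) (a q : EuclideanSpace ℝ (Fin n)) :
    ∫ w, Complex.exp (((-(2 * Real.pi * inner ℝ w a) : ℝ) : ℂ) * Complex.I) *
      ((‖stft v (q, w)‖ ^ 2 : ℝ) : ℂ)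
      = ∫ x, conj (windowed v q x) * windowed v q (x - a) := by
  have h := integral_inner_fourier_of_memLp (integrable_windowed v q) (memLp_windowed v q)
    ((integrable_windowed v q).comp_sub_right a)
    ((memLp_windowed v q).comp_measurePreserving (measurePreserving_sub_right volume a))
  simp only [RCLike.inner_apply, mul_comm _ (conj _)] at h
  refine Eq.trans (integral_congr_ae (.of_forall fun w => ?_)) h
  simp only
  rw [fourier_comp_sub, mul_left_comm, mul_comm (conj _), Complex.mul_conj,
    Complex.normSq_eq_norm_sq, stft]

theorem integrable_norm_sq_stft_slice (v : ModeSpace n) (q : EuclideanSpace ℝ (Fin n)) :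
    Integrable (fun w => ‖stft v (q, w)‖ ^ 2) :=
  (memLp_fourier (integrable_windowed v q) (memLp_windowed v q)).norm.integrable_sq

/-- The product of two shifted vacuum functions. -/
theorem vacuumFun_mul_vacuumFun_sub (a u : EuclideanSpace ℝ (Fin n)) :
    vacuumFun n (u + (2:ℝ)⁻¹ • a) * vacuumFun n (u - (2:ℝ)⁻¹ • a)
      = ((Real.pi ^ (-(n : ℝ) / 2) * Real.exp (-‖a‖ ^ 2 / 4) : ℝ) : ℂ)
        * Complex.exp (-1 * (‖u‖ : ℂ) ^ 2) := by
  -- The parallelogram law separates `u` from `a` in the sum of the two exponents.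
  have h1 := parallelogram_law_with_norm ℝ u ((2:ℝ)⁻¹ • a)
  have h2 : ‖(2:ℝ)⁻¹ • a‖ = 2⁻¹ * ‖a‖ := by rw [norm_smul]; norm_num
  rw [h2] at h1
  have h3 : Complex.exp (-1 * (‖u‖ : ℂ) ^ 2) = ((Real.exp (-‖u‖ ^ 2) : ℝ) : ℂ) := by
    push_cast; congr 1; ring
  rw [h3, vacuumFun, vacuumFun, ← Complex.ofReal_mul, ← Complex.ofReal_mul]
  congr 1
  rw [show (-(n : ℝ) / 2) = -(n : ℝ) / 4 + -(n : ℝ) / 4 by ring, Real.rpow_add Real.pi_pos]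
  have : Real.exp (-‖u + (2:ℝ)⁻¹ • a‖ ^ 2 / 2) * Real.exp (-‖u - (2:ℝ)⁻¹ • a‖ ^ 2 / 2)
      = Real.exp (-‖a‖ ^ 2 / 4) * Real.exp (-‖u‖ ^ 2) := by
    rw [← Real.exp_add, ← Real.exp_add]; congr 1; nlinarith
  linear_combination (Real.pi ^ (-(n : ℝ) / 4)) ^ 2 * this

/-- The ambiguity function of the vacuum. -/
theorem integral_vacuum_ambiguity (a b x : EuclideanSpace ℝ (Fin n)) :
    ∫ q, Complex.exp (((inner ℝ q b : ℝ) : ℂ) * Complex.I) *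
        (vacuumFun n (x - q) * vacuumFun n (x - a - q))
      = ((Real.exp (-(‖a‖ ^ 2 + ‖b‖ ^ 2) / 4) : ℝ) : ℂ) *
        Complex.exp (((inner ℝ b x - inner ℝ a b / 2 : ℝ) : ℂ) * Complex.I) := by
  -- Centring `q` at the midpoint of `x` and `x - a` symmetrises the two Gaussians and leaves the
  -- Fourier transform of a single Gaussian in `u`.
  rw [← integral_sub_left_eq_self _ volume (x - (2:ℝ)⁻¹ • a)]
  have : ∀ u : EuclideanSpace ℝ (Fin n),
      Complex.exp (((inner ℝ (x - (2:ℝ)⁻¹ • a - u) b : ℝ) : ℂ) * Complex.I) *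
        (vacuumFun n (x - (x - (2:ℝ)⁻¹ • a - u)) * vacuumFun n (x - a - (x - (2:ℝ)⁻¹ • a - u)))
      = (((Real.pi ^ (-(n : ℝ) / 2) * Real.exp (-‖a‖ ^ 2 / 4) : ℝ) : ℂ) *
        Complex.exp (((inner ℝ b x - inner ℝ a b / 2 : ℝ) : ℂ) * Complex.I)) *
        Complex.exp (-1 * (‖u‖ : ℂ) ^ 2 + (-Complex.I) * (inner ℝ b u : ℝ)) := by
    intro u
    have e1 : x - (x - (2:ℝ)⁻¹ • a - u) = u + (2:ℝ)⁻¹ • a := by abel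
    have e2 : x - a - (x - (2:ℝ)⁻¹ • a - u) = u - (2:ℝ)⁻¹ • a := by
      have : a = (2:ℝ)⁻¹ • a + (2:ℝ)⁻¹ • a := by rw [← add_smul]; norm_num
      nth_rewrite 1 [this]
      abel
    rw [e1, e2, vacuumFun_mul_vacuumFun_sub, Complex.exp_add]
    have e3 : Complex.exp (((inner ℝ (x - (2:ℝ)⁻¹ • a - u) b : ℝ) : ℂ) * Complex.I)
        = Complex.exp (((inner ℝ b x - inner ℝ a b / 2 : ℝ) : ℂ) * Complex.I)
          * Complex.exp ((-Complex.I) * (inner ℝ b u : ℝ)) := by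
      rw [← Complex.exp_add]
      congr 1
      rw [inner_sub_left, inner_sub_left, real_inner_smul_left, real_inner_comm b x,
        real_inner_comm b u]
      push_cast
      ring
    rw [e3]; ring
  simp_rw [this]
  rw [integral_const_mul, GaussianFourier.integral_cexp_neg_mul_sq_norm_add (by simp)]
  rw [mul_right_comm]
  congr 1
  have h1 : (Real.pi / 1 : ℂ) ^ ((Module.finrank ℝ (EuclideanSpace ℝ (Fin n)) : ℂ) / 2)
      = ((Real.pi ^ ((n : ℝ) / 2) : ℝ) : ℂ) := by
    rw [Complex.ofReal_cpow Real.pi_pos.le]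
    simp
  have h2 : Complex.exp ((-Complex.I) ^ 2 * (‖b‖ : ℂ) ^ 2 / (4 * 1))
      = ((Real.exp (-‖b‖ ^ 2 / 4) : ℝ) : ℂ) := by
    push_cast
    congr 1
    rw [neg_sq, Complex.I_sq]
    ring
  rw [h1, h2, ← Complex.ofReal_mul, ← Complex.ofReal_mul]
  congr 1
  have h3 : Real.pi ^ (-(n : ℝ) / 2) * Real.pi ^ ((n : ℝ) / 2) = 1 := by
    rw [← Real.rpow_add Real.pi_pos]; ring_nf; simp
  have h4 : Real.exp (-(‖a‖ ^ 2 + ‖b‖ ^ 2) / 4)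
      = Real.exp (-‖a‖ ^ 2 / 4) * Real.exp (-‖b‖ ^ 2 / 4) := by
    rw [← Real.exp_add]; ring_nf
  rw [h4]
  linear_combination (Real.exp (-‖a‖ ^ 2 / 4) * Real.exp (-‖b‖ ^ 2 / 4)) * h3

/-- The integrand of the autocorrelations of the windowed functions is integrable. -/
theorem integrable_windowed_autocorrelation (v : ModeSpace n) (a : EuclideanSpace ℝ (Fin n)) :
    Integrable (fun z : EuclideanSpace ℝ (Fin n) × EuclideanSpace ℝ (Fin n) =>
      conj (windowed v z.1 z.2) * windowed v z.1 (z.2 - a)) (volume.prod volume) := by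
  have hv : Integrable (fun x => conj (v x) * v (x - a)) :=
    (Lp.memLp v).star.integrable_mul
      ((Lp.memLp v).comp_measurePreserving (measurePreserving_sub_right volume a))
  -- The reflected argument puts the integrand in the form `f(x) g(q - x)` of a convolution of two
  -- integrable functions.
  have hg : Integrable (fun u => vacuumFun n (-u) * vacuumFun n (-u - a)) := by
    have : Integrable (fun u => vacuumFun n u * vacuumFun n (u - a)) :=
      (memLp_vacuumFun n).integrable_mul (memLp_vacuumFun_sub a)
    exact this.comp_neg
  refine (hv.convolution_integrand (ContinuousLinearMap.mul ℝ ℂ) hg).congr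
    (.of_forall fun z => ?_)
  simp only [ContinuousLinearMap.mul_apply', windowed, map_mul, conj_vacuumFun, neg_sub]
  rw [sub_right_comm z.2 z.1 a]
  ring

/-- By Plancherel each slice integral is `∫ |windowed v q|²`, which is integrable in `q` by the
autocorrelation bound at `a = 0`. -/
theorem integrable_norm_sq_stft (v : ModeSpace n) :
    Integrable (fun z => ‖stft v z‖ ^ 2) (volume.prod volume) := by
  have hm : AEStronglyMeasurable (fun z => ‖stft v z‖ ^ 2) (volume.prod volume) :=
    ((stronglyMeasurable_stft v).norm.pow 2).aestronglyMeasurable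
  rw [integrable_prod_iff hm]
  refine ⟨.of_forall fun q => integrable_norm_sq_stft_slice v q, ?_⟩
  refine (integrable_windowed_autocorrelation v 0).integral_prod_left.re.congr
    (.of_forall fun q => ?_)
  have := integral_inner_stft v 0 q
  simp only [inner_zero_right, mul_zero, neg_zero, Complex.ofReal_zero, zero_mul, Complex.exp_zero,
    one_mul] at this
  simp only
  rw [← this, integral_complex_ofReal]
  simp

theorem integrable_phase_mul_stft (v : ModeSpace n) (a b : EuclideanSpace ℝ (Fin n)) :
    Integrable (fun z : EuclideanSpace ℝ (Fin n) × EuclideanSpace ℝ (Fin n) =>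
      Complex.exp (((inner ℝ z.1 b - 2 * Real.pi * inner ℝ z.2 a : ℝ) : ℂ) * Complex.I) *
        ((‖stft v z‖ ^ 2 : ℝ) : ℂ)) (volume.prod volume) := by
  refine (integrable_norm_sq_stft v).ofReal.bdd_mul (c := 1)
    (Continuous.aestronglyMeasurable (by fun_prop)) (.of_forall fun z => ?_)
  rw [Complex.norm_exp_ofReal_mul_I]

theorem inner_displacement (v : ModeSpace n) (α : PhaseSpace n) :
    inner ℂ v (displacement α v) = ∫ x, dispPhase α x * (conj (v x) * v (x - posShift α)) := by
  rw [L2.inner_def]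
  refine integral_congr_ae ?_
  filter_upwards [displacement_ae α v] with x hx
  rw [hx, RCLike.inner_apply]
  ring

/-- After Plancherel in the frequency and Fubini, the integral over the window position is the
ambiguity function of the vacuum: its modulus is the Gaussian factor, its phase exactly `dispPhase
α`. -/
theorem integral_phase_mul_stft (v : ModeSpace n) (α : PhaseSpace n) :
    ∫ z, Complex.exp (((inner ℝ z.1 (momShift α) - 2 * Real.pi * inner ℝ z.2 (posShift α) : ℝ) : ℂ)
        * Complex.I) * ((‖stft v z‖ ^ 2 : ℝ) : ℂ) ∂(volume.prod volume)
      = ((Real.exp (-(‖posShift α‖ ^ 2 + ‖momShift α‖ ^ 2) / 4) : ℝ) : ℂ) *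
        inner ℂ v (displacement α v) := by
  rw [integral_prod _ (integrable_phase_mul_stft v _ _)]
  set a := posShift α
  set b := momShift α
  have e1 : ∀ q : EuclideanSpace ℝ (Fin n),
      ∫ w, Complex.exp (((inner ℝ q b - 2 * Real.pi * inner ℝ w a : ℝ) : ℂ) * Complex.I) *
        ((‖stft v (q, w)‖ ^ 2 : ℝ) : ℂ)
      = ∫ x, Complex.exp (((inner ℝ q b : ℝ) : ℂ) * Complex.I) *
          (conj (windowed v q x) * windowed v q (x - a)) := by
    intro q
    rw [integral_const_mul, ← integral_inner_stft, ← integral_const_mul]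
    congr 1 with w
    rw [← mul_assoc, ← Complex.exp_add]
    congr 2
    push_cast
    ring
  simp_rw [e1]
  rw [integral_integral_swap]
  · rw [inner_displacement, ← integral_const_mul]
    congr 1 with x
    have := integral_vacuum_ambiguity a b x
    rw [dispPhase, ← mul_assoc, ← this, ← integral_mul_const]
    congr 1 with q
    simp only [windowed, map_mul, conj_vacuumFun]
    ring
  · refine (integrable_windowed_autocorrelation v a).bdd_mul (c := 1)
      (Continuous.aestronglyMeasurable (by fun_prop)) (.of_forall fun z => ?_)
    rw [Complex.norm_exp_ofReal_mul_I]

end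

/-! ### States as countable mixtures of pure states -/

section

open scoped ComplexConjugate

section Hilbert

variable {H : Type*} [NormedAddCommGroup H] [InnerProductSpace ℂ H]

/-- A positive operator is the square of a symmetric operator. -/
theorem exists_symmetric_sqrt [CompleteSpace H] {T : H →L[ℂ] H} (hT : T.IsPositive) :
    ∃ A : H →L[ℂ] H, (∀ x y, inner ℂ (A x) y = inner ℂ x (A y)) ∧ ∀ x, T x = A (A x) := by
  have h0 : 0 ≤ T := (ContinuousLinearMap.nonneg_iff_isPositive T).2 hT
  refine ⟨CFC.sqrt T, ?_, fun x => ?_⟩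
  · have := ((ContinuousLinearMap.nonneg_iff_isPositive _).1 (CFC.sqrt_nonneg T)).isSymmetric
    exact fun x y => this x y
  · conv_lhs => rw [← CFC.sqrt_mul_sqrt_self T h0]
    rfl

variable {ι : Type*}

theorem _root_.HilbertBasis.hasSum_norm_inner_sq (b : HilbertBasis ι ℂ H) (x : H) :
    HasSum (fun i => ‖inner ℂ (b i) x‖ ^ 2) (‖x‖ ^ 2) := by
  have h := Complex.hasSum_re (b.hasSum_inner_mul_inner x x)
  have e : (inner ℂ x x : ℂ).re = ‖x‖ ^ 2 := by
    rw [inner_self_eq_norm_sq_to_K]; simp [← Complex.ofReal_pow]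
  rw [e] at h
  convert h using 2 with i
  rw [← inner_conj_symm x, mul_comm, Complex.mul_conj, Complex.normSq_eq_norm_sq, Complex.ofReal_re]

/-- Distinct basis vectors are `√2` apart, so the balls of radius `1/2` around them are disjoint.
Countability is needed below to measure and integrate sums over the basis. -/
theorem _root_.HilbertBasis.countable_of_separableSpace [TopologicalSpace.SeparableSpace H]
    (b : HilbertBasis ι ℂ H) :
    Countable ι := by
  have h : (Set.univ : Set ι).Countable := by
    refine Set.PairwiseDisjoint.countable_of_isOpen (s := fun i => Metric.ball (b i) (1 / 2)) ?_
      (fun _ _ => Metric.isOpen_ball) (fun i _ => ⟨b i, Metric.mem_ball_self (by norm_num)⟩)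
    intro i _ j _ hij
    refine Metric.ball_disjoint_ball ?_
    have h1 : ‖b i - b j‖ ^ 2 = 2 := by
      rw [@norm_sub_sq ℂ, b.orthonormal.1 i, b.orthonormal.1 j, b.orthonormal.2 hij]
      norm_num
    rw [dist_eq_norm]
    nlinarith [norm_nonneg (b i - b j)]
  exact Set.countable_univ_iff.1 h

/-- The trace of `A² T`, with `A` a symmetric Hilbert-Schmidt operator. -/
theorem _root_.HilbertBasis.tsum_inner_comp_eq [CompleteSpace H] (b : HilbertBasis ι ℂ H)
    (A T : H →L[ℂ] H)
    (hA : ∀ x y, inner ℂ (A x) y = inner ℂ x (A y)) (hs : Summable fun i => ‖A (b i)‖ ^ 2) :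
    ∑' i, inner ℂ (b i) (A (A (T (b i)))) = ∑' k, inner ℂ (A (b k)) (T (A (b k))) := by
  -- Expanding both sides in the basis gives one double series summed in two orders. It converges
  -- absolutely because `A` and `S ∘L A` are both Hilbert-Schmidt.
  set S := ContinuousLinearMap.adjoint T
  have e1 : ∀ i, inner ℂ (b i) (A (A (T (b i))))
      = ∑' k, inner ℂ (b i) (A (b k)) * inner ℂ (S (A (b k))) (b i) := by
    intro i
    rw [← hA, ← (b.hasSum_inner_mul_inner (A (b i)) (A (T (b i)))).tsum_eq]
    refine tsum_congr fun k => ?_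
    rw [hA, ← hA (b k), ContinuousLinearMap.adjoint_inner_left]
  have e2 : ∀ k, inner ℂ (A (b k)) (T (A (b k)))
      = ∑' i, inner ℂ (b i) (A (b k)) * inner ℂ (S (A (b k))) (b i) := by
    intro k
    rw [← ContinuousLinearMap.adjoint_inner_left,
      ← (b.hasSum_inner_mul_inner (S (A (b k))) (A (b k))).tsum_eq]
    exact tsum_congr fun i => mul_comm _ _
  simp_rw [e1, e2]
  refine Summable.tsum_comm
    (f := fun k i => inner ℂ (b i) (A (b k)) * inner ℂ (S (A (b k))) (b i)) ?_
  have hp : ∀ W : H →L[ℂ] H, (Summable fun k => ‖W (b k)‖ ^ (2:ℕ)) →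
      Summable fun p : ι × ι => ‖inner ℂ (b p.2) (W (b p.1))‖ ^ 2 := by
    intro W hW
    have h0 : (0 : ι × ι → ℝ) ≤ fun p => ‖inner ℂ (b p.2) (W (b p.1))‖ ^ 2 :=
      fun p => sq_nonneg _
    rw [summable_prod_of_nonneg h0]
    refine ⟨fun k => (b.hasSum_norm_inner_sq (W (b k))).summable, ?_⟩
    exact hW.congr fun k => (b.hasSum_norm_inner_sq (W (b k))).tsum_eq.symm
  have h1 := hp A hs
  have h2 := hp (S ∘L A) (by
    refine Summable.of_nonneg_of_le (fun _ => sq_nonneg _) (fun k => ?_)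
      (hs.mul_left (‖S‖ ^ 2))
    rw [← mul_pow]
    exact pow_le_pow_left₀ (norm_nonneg _) (S.le_opNorm _) 2)
  refine Summable.of_norm_bounded (h1.add h2) fun p => ?_
  simp only [Function.uncurry, ContinuousLinearMap.comp_apply]
  rw [norm_mul, norm_inner_symm (S _)]
  nlinarith [sq_nonneg (‖inner ℂ (b p.2) (A (b p.1))‖ - ‖inner ℂ (b p.2) (S (A (b p.1)))‖),
    sq_nonneg (‖inner ℂ (b p.2) (A (b p.1))‖), sq_nonneg (‖inner ℂ (b p.2) (S (A (b p.1)))‖)]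

end Hilbert

variable {n : ℕ}

instance : TopologicalSpace.SeparableSpace (ModeSpace n) :=
  haveI : Fact ((2 : ENNReal) ≠ ⊤) := ⟨by norm_num⟩
  inferInstance

instance : Countable (basisIndex n) := (basis n).countable_of_separableSpace

namespace QState

/-- A state is a countable mixture of unnormalised pure states. -/
theorem exists_decomposition (ρ : QState n) :
    ∃ v : basisIndex n → ModeSpace n, HasSum (fun k => ‖v k‖ ^ 2) 1 ∧
      (∀ ψ, HasSum (fun k => ‖inner ℂ ψ (v k)‖ ^ 2) (inner ℂ ψ (ρ.op ψ)).re) ∧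
      ∀ T : ModeSpace n →L[ℂ] ModeSpace n, opTrace (ρ.op ∘L T) = ∑' k, inner ℂ (v k) (T (v k)) := by
  obtain ⟨A, hA, hAA⟩ := exists_symmetric_sqrt ρ.isPositive
  have key : ∀ x, (inner ℂ x (ρ.op x)).re = ‖A x‖ ^ 2 := by
    intro x
    rw [hAA, ← hA, inner_self_eq_norm_sq_to_K]; simp [← Complex.ofReal_pow]
  have h1 : HasSum (fun k => ‖A (basis n k)‖ ^ 2) 1 := by
    have := Complex.hasSum_re ρ.hasSum_trace
    simpa only [key, Complex.one_re] using this
  -- With `ρ = A²` and `v k = A (e k)`, the operator `∑ k, |v k⟩⟨v k|` is `A² = ρ`.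
  refine ⟨fun k => A (basis n k), h1, fun ψ => ?_, fun T => ?_⟩
  · rw [key]
    convert (basis n).hasSum_norm_inner_sq (A ψ) using 2 with k
    rw [← hA, norm_inner_symm]
  · rw [← (basis n).tsum_inner_comp_eq A T hA h1.summable]
    exact tsum_congr fun i => by simp [hAA]

end QState

end

/-! ### The heterodyne law and its characteristic function -/

section

open scoped ComplexConjugate

variable {n : ℕ}

/-- `(x, y) ↦ x + i y` as an isometry. -/
def ofReIm (n : ℕ) :
    WithLp 2 (EuclideanSpace ℝ (Fin n) × EuclideanSpace ℝ (Fin n)) ≃ₗᵢ[ℝ] PhaseSpace n where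
  toFun z := WithLp.toLp 2 fun i => ⟨z.fst i, z.snd i⟩
  invFun ζ := WithLp.toLp 2 (WithLp.toLp 2 fun i => (ζ i).re, WithLp.toLp 2 fun i => (ζ i).im)
  map_add' x y := by ext i; simp [Complex.ext_iff]
  map_smul' c x := by ext i; simp [Complex.ext_iff]
  left_inv z := by
    refine WithLp.ofLp_injective 2 (Prod.ext ?_ ?_) <;> ext i <;> simp
  right_inv ζ := by ext i; simp
  norm_map' z := by
    rw [← sq_eq_sq₀ (norm_nonneg _) (norm_nonneg _), WithLp.prod_norm_sq_eq_of_L2,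
      EuclideanSpace.norm_sq_eq, EuclideanSpace.norm_sq_eq, EuclideanSpace.norm_sq_eq,
      ← Finset.sum_add_distrib]
    refine Finset.sum_congr rfl fun i _ => ?_
    rw [← Complex.normSq_eq_norm_sq, Complex.normSq_apply]
    simp [sq]

/-- Position shift and momentum shift divided by `2π`, as coordinates on phase space. -/
def shifts (ζ : PhaseSpace n) : EuclideanSpace ℝ (Fin n) × EuclideanSpace ℝ (Fin n) :=
  (posShift ζ, (2 * Real.pi)⁻¹ • momShift ζ)

/-- The inverse of `shifts`. -/
def ofShifts (z : EuclideanSpace ℝ (Fin n) × EuclideanSpace ℝ (Fin n)) : PhaseSpace n :=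
  ofReIm n (WithLp.toLp 2 ((√2)⁻¹ • z.1, (√2 * Real.pi) • z.2))

theorem posShift_ofShifts (z : EuclideanSpace ℝ (Fin n) × EuclideanSpace ℝ (Fin n)) :
    posShift (ofShifts z) = z.1 := by
  ext i
  simp [posShift, ofShifts, ofReIm]

theorem momShift_ofShifts (z : EuclideanSpace ℝ (Fin n) × EuclideanSpace ℝ (Fin n)) :
    momShift (ofShifts z) = (2 * Real.pi) • z.2 := by
  ext i
  simp only [momShift, ofShifts, ofReIm, LinearIsometryEquiv.coe_mk, LinearEquiv.coe_mk,
    LinearMap.coe_mk, AddHom.coe_mk, WithLp.toLp_snd, PiLp.smul_apply, smul_eq_mul]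
  rw [← mul_assoc, ← mul_assoc, Real.mul_self_sqrt zero_le_two]

theorem shifts_ofShifts (z : EuclideanSpace ℝ (Fin n) × EuclideanSpace ℝ (Fin n)) :
    shifts (ofShifts z) = z := by
  rw [shifts, posShift_ofShifts, momShift_ofShifts, inv_smul_smul₀ (by positivity)]

theorem continuous_shifts : Continuous (shifts : PhaseSpace n → _) := by
  unfold shifts posShift momShift
  fun_prop

theorem continuous_ofShifts : Continuous (ofShifts (n := n)) := by
  unfold ofShifts
  refine (ofReIm n).continuous.comp ?_
  fun_prop

/-- The two scalings contribute `(√2)ⁿ` and `(√2 π)⁻ⁿ`. Their product `π⁻ⁿ` is the normalisation of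
the heterodyne density. -/
theorem map_ofShifts :
    Measure.map (ofShifts (n := n)) (volume.prod volume)
      = ENNReal.ofReal (Real.pi ^ n)⁻¹ • volume := by
  have h1 : (ofShifts (n := n)) = (ofReIm n) ∘ (WithLp.toLp 2) ∘
      Prod.map (fun x => (√2)⁻¹ • x) (fun x => (√2 * Real.pi) • x) := rfl
  rw [h1, ← Measure.map_map (ofReIm n).continuous.measurable (by fun_prop),
    ← Measure.map_map (by fun_prop) (by fun_prop),
    ← Measure.map_prod_map _ _ (by fun_prop) (by fun_prop),
    Measure.map_addHaar_smul _ (by positivity), Measure.map_addHaar_smul _ (by positivity),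
    Measure.prod_smul_left, Measure.prod_smul_right, smul_smul, Measure.map_smul, Measure.map_smul]
  have h2 := (WithLp.volume_preserving_toLp (EuclideanSpace ℝ (Fin n))
    (EuclideanSpace ℝ (Fin n))).map_eq
  rw [Measure.volume_eq_prod] at h2
  rw [h2, (ofReIm n).measurePreserving.map_eq, ← ENNReal.ofReal_mul (abs_nonneg _)]
  congr 2
  rw [finrank_euclideanSpace_fin, abs_of_pos (by positivity), abs_of_pos (by positivity),
    inv_pow, mul_pow, mul_inv, inv_inv, ← mul_assoc, mul_inv_cancel₀ (by positivity), one_mul]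

/-- Matches the symplectic phase of the estimator with the phase in `integral_phase_mul_stft`. -/
theorem inner_sub_inner (ζ α : PhaseSpace n) :
    inner ℂ ζ α - inner ℂ α ζ
      = ((inner ℝ (shifts ζ).1 (momShift α)
          - 2 * Real.pi * inner ℝ (shifts ζ).2 (posShift α) : ℝ) : ℂ) * Complex.I := by
  have e : 2 * Real.pi * inner ℝ (shifts ζ).2 (posShift α)
      = inner ℝ (momShift ζ) (posShift α) := by
    rw [shifts, real_inner_smul_left, ← mul_assoc, mul_inv_cancel₀ (by positivity), one_mul]
  rw [e]
  simp only [shifts, PiLp.inner_apply, posShift, momShift, ← Finset.sum_sub_distrib,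
    Complex.ofReal_sum, Finset.sum_mul]
  refine Finset.sum_congr rfl fun i _ => ?_
  have h2 : √2 * √2 = 2 := Real.mul_self_sqrt zero_le_two
  apply Complex.ext
  · simp
    ring
  · simp
    linear_combination (-(ζ i).re * (α i).im + (ζ i).im * (α i).re) * h2

theorem norm_posShift_sq_add (α : PhaseSpace n) :
    ‖posShift α‖ ^ 2 + ‖momShift α‖ ^ 2 = 2 * ‖α‖ ^ 2 := by
  simp only [EuclideanSpace.norm_sq_eq, posShift, momShift, ← Finset.sum_add_distrib,
    Finset.mul_sum]
  refine Finset.sum_congr rfl fun i _ => ?_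
  rw [← Complex.normSq_eq_norm_sq, Complex.normSq_apply]
  simp only [Real.norm_eq_abs, sq_abs, mul_pow, Real.sq_sqrt zero_le_two]
  ring

theorem measurable_norm_sq_stft (v : ModeSpace n) : Measurable fun z => ‖stft v z‖ ^ 2 :=
  ((stronglyMeasurable_stft v).norm.pow 2).measurable

namespace QState

/-- The Husimi function of `ρ` in the coordinates `shifts`. -/
def husimi (ρ : QState n) (z : EuclideanSpace ℝ (Fin n) × EuclideanSpace ℝ (Fin n)) : ℝ :=
  ∑' k, ‖stft (ρ.exists_decomposition.choose k) z‖ ^ 2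

theorem hasSum_husimi (ρ : QState n) (ζ : PhaseSpace n) :
    HasSum (fun k => ‖stft (ρ.exists_decomposition.choose k) (shifts ζ)‖ ^ 2)
      (inner ℂ (coherent ζ) (ρ.op (coherent ζ))).re := by
  have := ρ.exists_decomposition.choose_spec.2.1 (coherent ζ)
  simpa only [norm_inner_coherent, shifts] using this

theorem measurable_husimi (ρ : QState n) : Measurable ρ.husimi :=
  Measurable.tsum fun _ => measurable_norm_sq_stft _

theorem measurable_husimi_shifts (ρ : QState n) :
    Measurable fun ζ => ENNReal.ofReal (ρ.husimi (shifts ζ)) :=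
  (ρ.measurable_husimi.comp continuous_shifts.measurable).ennreal_ofReal

theorem husimi_nonneg (ρ : QState n) (z) : 0 ≤ ρ.husimi z := tsum_nonneg fun _ => by positivity

theorem husimi_shifts (ρ : QState n) (ζ : PhaseSpace n) :
    ρ.husimi (shifts ζ) = (inner ℂ (coherent ζ) (ρ.op (coherent ζ))).re :=
  (ρ.hasSum_husimi ζ).tsum_eq

theorem heterodyneLaw_eq (ρ : QState n) :
    ρ.heterodyneLaw = (Measure.map ofShifts (volume.prod volume)).withDensity
      fun ζ => ENNReal.ofReal (ρ.husimi (shifts ζ)) := by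
  rw [map_ofShifts, withDensity_smul_measure, ← withDensity_smul _ ρ.measurable_husimi_shifts,
    heterodyneLaw]
  congr 1 with ζ
  rw [Pi.smul_apply, smul_eq_mul, ← ENNReal.ofReal_mul (by positivity), husimi_shifts,
    div_eq_inv_mul]

theorem heterodyneLaw_eq_map (ρ : QState n) :
    ρ.heterodyneLaw = Measure.map ofShifts
      ((volume.prod volume).withDensity fun z => ENNReal.ofReal (ρ.husimi z)) := by
  rw [heterodyneLaw_eq]
  ext s hs
  have hc := continuous_ofShifts (n := n)
  rw [withDensity_apply _ hs, Measure.map_apply hc.measurable hs,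
    withDensity_apply _ (hc.measurable hs),
    setLIntegral_map hs ρ.measurable_husimi_shifts hc.measurable]
  simp [shifts_ofShifts]

/-- The case `α = 0` of `integral_phase_mul_stft`, where the displacement is trivial. -/
theorem integral_norm_sq_stft (v : ModeSpace n) :
    ∫ z, ‖stft v z‖ ^ 2 ∂(volume.prod volume) = ‖v‖ ^ 2 := by
  have h := integral_phase_mul_stft v 0
  have e1 : posShift (0 : PhaseSpace n) = 0 := by ext i; simp [posShift]
  have e2 : momShift (0 : PhaseSpace n) = 0 := by ext i; simp [momShift]
  have e3 : inner ℂ v (displacement 0 v) = ((‖v‖ ^ 2 : ℝ) : ℂ) := by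
    have : inner ℂ v (displacement 0 v) = inner ℂ v v := by
      rw [inner_displacement, L2.inner_def]
      congr 1 with x
      simp [dispPhase, e1, e2, Complex.conj_mul']
    rw [this, inner_self_eq_norm_sq_to_K]
    simp
  rw [e1, e2, e3] at h
  simp only [inner_zero_right, mul_zero, sub_zero, norm_zero, Complex.ofReal_zero, zero_mul,
    Complex.exp_zero, one_mul, integral_complex_ofReal] at h
  rw [show -((0 : ℝ) ^ 2 + 0 ^ 2) / 4 = 0 by norm_num, Real.exp_zero, Complex.ofReal_one,
    one_mul] at h
  exact Complex.ofReal_injective h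

/-- By Tonelli the total mass is `∑ k, ‖v k‖² = Tr ρ = 1`. -/
instance (ρ : QState n) : IsProbabilityMeasure ρ.heterodyneLaw := by
  rw [heterodyneLaw_eq_map]
  have : IsProbabilityMeasure ((volume.prod volume).withDensity
      fun z : EuclideanSpace ℝ (Fin n) × EuclideanSpace ℝ (Fin n) =>
        ENNReal.ofReal (ρ.husimi z)) := by
    constructor
    rw [withDensity_apply _ MeasurableSet.univ, Measure.restrict_univ]
    have hs := ρ.exists_decomposition.choose_spec.1
    have e : ∀ z, ENNReal.ofReal (ρ.husimi z)
        = ∑' k, ENNReal.ofReal (‖stft (ρ.exists_decomposition.choose k) z‖ ^ 2) := by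
      intro z
      refine ENNReal.ofReal_tsum_of_nonneg (fun _ => by positivity) ?_
      have := (ρ.hasSum_husimi (ofShifts z)).summable
      simpa only [shifts_ofShifts] using this
    simp_rw [e]
    rw [lintegral_tsum fun k => (measurable_norm_sq_stft _).ennreal_ofReal.aemeasurable]
    have e2 : ∀ k, ∫⁻ z, ENNReal.ofReal (‖stft (ρ.exists_decomposition.choose k) z‖ ^ 2)
        ∂(volume.prod volume) = ENNReal.ofReal (‖ρ.exists_decomposition.choose k‖ ^ 2) := by
      intro k
      rw [← ofReal_integral_eq_lintegral_ofReal (integrable_norm_sq_stft _)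
        (.of_forall fun _ => by positivity), integral_norm_sq_stft]
    simp_rw [e2]
    rw [← ENNReal.ofReal_tsum_of_nonneg (fun _ => by positivity) hs.summable, hs.tsum_eq,
      ENNReal.ofReal_one]
  exact Measure.isProbabilityMeasure_map continuous_ofShifts.aemeasurable

/-- The characteristic function of the heterodyne outcome. -/
theorem integral_heterodyneLaw (ρ : QState n) (α : PhaseSpace n) :
    ∫ ζ, Complex.exp (inner ℂ ζ α - inner ℂ α ζ) ∂ρ.heterodyneLaw
      = ((Real.exp (-‖α‖ ^ 2 / 2) : ℝ) : ℂ) * ρ.chi α := by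
  have hsum : ∀ z, Summable fun k => ‖stft (ρ.exists_decomposition.choose k) z‖ ^ 2 := by
    intro z
    have := (ρ.hasSum_husimi (ofShifts z)).summable
    simpa only [shifts_ofShifts] using this
  rw [heterodyneLaw_eq_map, integral_map continuous_ofShifts.aemeasurable
      (Continuous.aestronglyMeasurable (by fun_prop)),
    integral_withDensity_eq_integral_toReal_smul ρ.measurable_husimi.ennreal_ofReal
      (.of_forall fun _ => ENNReal.ofReal_lt_top)]
  have h := hasSum_integral_of_summable_integral_norm
    (fun k => integrable_phase_mul_stft (ρ.exists_decomposition.choose k) (posShift α) (momShift α))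
    (by
      simp only [norm_mul, Complex.norm_exp_ofReal_mul_I, one_mul, Complex.norm_real, norm_pow,
        norm_norm, integral_norm_sq_stft]
      exact ρ.exists_decomposition.choose_spec.1.summable)
  rw [chi, ρ.exists_decomposition.choose_spec.2.2, ← tsum_mul_left]
  simp_rw [integral_phase_mul_stft, norm_posShift_sq_add] at h
  have e : -(2 * ‖α‖ ^ 2) / 4 = -‖α‖ ^ 2 / 2 := by ring
  rw [e] at h
  rw [h.tsum_eq]
  congr 1 with z
  rw [tsum_mul_left, ← Complex.ofReal_tsum, inner_sub_inner, shifts_ofShifts,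
    ENNReal.toReal_ofReal (ρ.husimi_nonneg z), Complex.real_smul, mul_comm]
  rfl

/-- Unbiasedness of the estimator. It is also the source of the value at 0, the symmetry and the
continuity of `χ_ρ`. -/
theorem chi_eq (ρ : QState n) (α : PhaseSpace n) :
    ρ.chi α = ((Real.exp (‖α‖ ^ 2 / 2) : ℝ) : ℂ) *
      ∫ ζ, Complex.exp (inner ℂ ζ α - inner ℂ α ζ) ∂ρ.heterodyneLaw := by
  rw [integral_heterodyneLaw, ← mul_assoc, ← Complex.ofReal_mul, ← Real.exp_add]
  simp [neg_div]

theorem norm_exp_inner_sub (ζ α : PhaseSpace n) :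
    ‖Complex.exp (inner ℂ ζ α - inner ℂ α ζ)‖ = 1 := by
  rw [inner_sub_inner, Complex.norm_exp_ofReal_mul_I]

theorem chi_zero (ρ : QState n) : ρ.chi 0 = 1 := by
  rw [chi_eq]; simp

theorem chi_neg (ρ : QState n) (α : PhaseSpace n) : ρ.chi (-α) = conj (ρ.chi α) := by
  rw [chi_eq, chi_eq, map_mul, norm_neg, Complex.conj_ofReal, ← integral_conj]
  congr 2 with ζ
  rw [← Complex.exp_conj]
  congr 1
  simp
  ring

theorem continuous_chi (ρ : QState n) : Continuous ρ.chi := by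
  have : ρ.chi = fun α => ((Real.exp (‖α‖ ^ 2 / 2) : ℝ) : ℂ) *
      ∫ ζ, Complex.exp (inner ℂ ζ α - inner ℂ α ζ) ∂ρ.heterodyneLaw := funext ρ.chi_eq
  rw [this]
  refine Continuous.mul (by fun_prop) ?_
  refine continuous_of_dominated (bound := fun _ => 1)
    (fun α => Continuous.aestronglyMeasurable (by fun_prop))
    (fun α => .of_forall fun ζ => (norm_exp_inner_sub ζ α).le) (integrable_const _)
    (.of_forall fun ζ => by fun_prop)

end QState

end

/-! ### Gaussian decay of `χ_ρ` from non-negativity of the quasiprobability -/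

section

open scoped FourierTransform ComplexConjugate ContDiff Convolution

section PositiveKernel

variable {E : Type*} [NormedAddCommGroup E] [InnerProductSpace ℝ E] [FiniteDimensional ℝ E]
  [MeasurableSpace E] [BorelSpace E]

/-- The Fourier transform of an even real function is real. -/
theorem conj_fourier_of_even {f : E → ℂ} (hr : ∀ x, conj (f x) = f x) (he : ∀ x, f (-x) = f x)
    (w : E) : conj (𝓕 f w) = 𝓕 f w := by
  rw [Real.fourier_eq', ← integral_conj, ← integral_neg_eq_self]
  congr 1 with x
  rw [smul_eq_mul, smul_eq_mul, map_mul, hr, he, ← Complex.exp_conj]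
  simp [Complex.conj_ofNat]

/-- There are non-negative Schwartz functions with arbitrarily small support and non-negative
Fourier transform. -/
theorem exists_schwartz_nonneg_fourier_nonneg {r : ℝ} (hr : 0 < r) :
    ∃ (B : SchwartzMap E ℂ) (K : E → ℝ), (∀ x, B x = K x) ∧ (∀ x, 0 ≤ K x) ∧ K ≠ 0 ∧
      (∀ x, K x ≠ 0 → ‖x‖ < r) ∧ ∀ w, ∃ t : ℝ, 0 ≤ t ∧ 𝓕 (B : E → ℂ) w = t := by
  -- `B` is the convolution square of an even real bump: its Fourier transform is the square of a
  -- real function, and the outer radius `r / 2` doubles to `r`.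
  let b : ContDiffBump (0 : E) := ⟨r / 4, r / 2, by positivity, by linarith⟩
  have hbc : HasCompactSupport (fun x => (b x : ℂ)) :=
    b.hasCompactSupport.comp_left (g := Complex.ofReal) rfl
  have hbs : ContDiff ℝ ∞ (fun x => (b x : ℂ)) := Complex.ofRealCLM.contDiff.comp b.contDiff
  set f : SchwartzMap E ℂ := hbc.toSchwartzMap hbs with hf
  have hfb : ∀ x, f x = (b x : ℂ) := fun x => rfl
  set B := SchwartzMap.convolution (ContinuousLinearMap.mul ℂ ℂ) f f with hB
  have hBK : ∀ x, B x = ((∫ t, b t * b (x - t) : ℝ) : ℂ) := by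
    intro x
    rw [hB, SchwartzMap.convolution_apply, MeasureTheory.convolution_def, ← integral_complex_ofReal]
    congr 1 with t
    simp [hfb]
  have hF : ∀ w, 𝓕 (B : E → ℂ) w = 𝓕 (f : E → ℂ) w * 𝓕 (f : E → ℂ) w := by
    intro w
    rw [← SchwartzMap.fourier_coe, hB, SchwartzMap.fourier_convolution]
    simp [SchwartzMap.fourier_coe]
  have hreal : ∀ w, ((𝓕 (f : E → ℂ) w).re : ℂ) = 𝓕 (f : E → ℂ) w := by
    intro w
    rw [← Complex.conj_eq_iff_re]
    exact conj_fourier_of_even (fun x => by rw [hfb, Complex.conj_ofReal])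
      (fun x => by rw [hfb, hfb, b.neg]) w
  refine ⟨B, fun x => ∫ t, b t * b (x - t), hBK,
    fun x => integral_nonneg fun t => mul_nonneg b.nonneg b.nonneg, fun h0 => ?_, fun x hx => ?_,
    fun w => ⟨(𝓕 (f : E → ℂ) w).re ^ 2, sq_nonneg _, ?_⟩⟩
  · have hB0 : (B : E → ℂ) = 0 := by
      ext x
      rw [hBK, congrFun h0 x]
      simp
    have h1 := hF 0
    have h2 : 𝓕 (B : E → ℂ) 0 = 0 := by
      rw [hB0, Real.fourier_eq']
      simp
    have h3 : 𝓕 (f : E → ℂ) 0 = ((∫ t, b t : ℝ) : ℂ) := by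
      rw [Real.fourier_eq', ← integral_complex_ofReal]
      congr 1 with t
      simp [hfb]
    rw [h2, h3, ← Complex.ofReal_mul, eq_comm, Complex.ofReal_eq_zero, mul_self_eq_zero] at h1
    exact b.integral_pos.ne' h1
  · by_contra hlt
    refine hx (integral_eq_zero_of_ae (.of_forall fun t => ?_))
    by_cases ht : ‖t‖ < r / 2
    · have h1 : r / 2 ≤ ‖x - t‖ := by
        have := norm_sub_norm_le x t
        linarith
      have : b (x - t) = 0 := b.zero_of_le_dist (by simpa [b] using h1)
      simp [this]
    · have : b t = 0 := b.zero_of_le_dist (by simpa [b] using ht)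
      simp [this]
  · rw [hF, sq, Complex.ofReal_mul, hreal]

/-- A continuous function whose averages against all kernels concentrating at the origin are
non-negative is non-negative at the origin. -/
theorem nonneg_of_integral_kernel_nonneg {p : E → ℝ} (hp : Continuous p)
    (h : ∀ r > 0, ∃ k : E → ℝ, Continuous k ∧ (∀ x, 0 ≤ k x) ∧ k ≠ 0 ∧
      (∀ x, k x ≠ 0 → ‖x‖ < r) ∧ 0 ≤ ∫ x, p x * k x) : 0 ≤ p 0 := by
  by_contra! hlt
  obtain ⟨r, hr, hrp⟩ := Metric.continuousAt_iff.1 (hp.continuousAt (x := 0)) (-p 0 / 2) (by linarith)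
  obtain ⟨k, hkc, hk0, hkn, hks, hint⟩ := h r hr
  have hcs : HasCompactSupport k := by
    refine HasCompactSupport.intro (isCompact_closedBall (0 : E) r) fun x hx => ?_
    by_contra hne
    exact hx (by simpa using (hks x hne).le)
  have hpos : 0 < ∫ x, k x := by
    obtain ⟨x, hx⟩ := Function.ne_iff.1 hkn
    exact hkc.integral_pos_of_hasCompactSupport_nonneg_nonzero hcs hk0 hx
  have hle : ∫ x, p x * k x ≤ ∫ x, p 0 / 2 * k x := by
    refine integral_mono ((hp.mul hkc).integrable_of_hasCompactSupport hcs.mul_left)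
      ((hkc.integrable_of_hasCompactSupport hcs).const_mul _) fun x => ?_
    by_cases hx : k x = 0
    · simp [hx]
    · have := hrp (x := x) (by simpa using hks x hx)
      rw [Real.dist_eq, abs_lt] at this
      exact mul_le_mul_of_nonneg_right (by linarith) (hk0 x)
  rw [integral_const_mul] at hle
  nlinarith

end PositiveKernel

variable {n : ℕ}

/-- The frequency at which the Fourier transform is evaluated by `phaseFourier`. -/
def phaseFreq (α : PhaseSpace n) : PhaseSpace n := -((Real.pi)⁻¹ : ℝ) • (Complex.I • α)

theorem continuous_phaseFreq : Continuous (phaseFreq (n := n)) := by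
  unfold phaseFreq
  fun_prop

theorem norm_phaseFreq (α : PhaseSpace n) : ‖phaseFreq α‖ = Real.pi⁻¹ * ‖α‖ := by
  rw [phaseFreq, norm_smul, norm_smul]
  simp [Real.pi_pos.le]

theorem phaseFreq_add (α β : PhaseSpace n) : phaseFreq (α + β) = phaseFreq α + phaseFreq β := by
  simp [phaseFreq, smul_add]

theorem phaseFreq_sub (α β : PhaseSpace n) : phaseFreq (α - β) = phaseFreq α - phaseFreq β := by
  simp [phaseFreq, sub_eq_add_neg]

theorem surjective_phaseFreq : Function.Surjective (phaseFreq (n := n)) := by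
  intro w
  refine ⟨Real.pi • Complex.I • w, ?_⟩
  rw [phaseFreq, smul_comm Complex.I Real.pi, smul_smul Complex.I, Complex.I_mul_I, smul_smul]
  simp [Real.pi_ne_zero]

/-- The exponent `α†β - β†α = 2i Im(α†β)` is `-2πi` times the real inner product of `β` with
`phaseFreq α`. -/
theorem phaseFourier_eq (φ : PhaseSpace n → ℝ) (α : PhaseSpace n) :
    phaseFourier φ α
      = ((Real.pi ^ (2 * n))⁻¹ : ℝ) * 𝓕 (fun β => (φ β : ℂ)) (phaseFreq α) := by
  rw [phaseFourier, Real.fourier_eq']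
  congr 2 with β
  rw [smul_eq_mul, mul_comm]
  congr 2
  rw [phaseFreq, real_inner_smul_right]
  simp only [PiLp.inner_apply, ← Finset.sum_sub_distrib]
  push_cast
  simp only [Finset.mul_sum, Finset.sum_mul]
  refine Finset.sum_congr rfl fun i _ => ?_
  apply Complex.ext
  · simp
    ring
  · simp
    field_simp
    ring

theorem integral_linear_combination {X : Type*} [MeasurableSpace X] {μ : Measure X}
    {f g h : X → ℂ} (hf : Integrable f μ) (hg : Integrable g μ) (hh : Integrable h μ)
    (a b c : ℂ) : ∫ x, (a * f x + b * g x + c * h x) ∂μ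
      = a * ∫ x, f x ∂μ + b * ∫ x, g x ∂μ + c * ∫ x, h x ∂μ := by
  have h1 : Integrable (fun x => a * f x + b * g x) μ := (hf.const_mul a).add (hg.const_mul b)
  rw [integral_add h1 (hh.const_mul c), integral_add (hf.const_mul a) (hg.const_mul b),
    integral_const_mul, integral_const_mul, integral_const_mul]

namespace QState

theorem continuous_chiOrdered (ρ : QState n) (s : ℝ) : Continuous (ρ.chiOrdered s) := by
  unfold chiOrdered
  exact Continuous.mul (by fun_prop) ρ.continuous_chi

theorem chiOrdered_neg (ρ : QState n) (s : ℝ) (α : PhaseSpace n) :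
    ρ.chiOrdered s (-α) = conj (ρ.chiOrdered s α) := by
  simp only [chiOrdered, map_mul, chi_neg, norm_neg, Complex.conj_ofReal]

theorem chiOrdered_zero (ρ : QState n) (s : ℝ) : ρ.chiOrdered s 0 = 1 := by
  simp [chiOrdered, chi_zero]

/-- Non-negativity of the quasiprobability distribution, tested in the Fourier domain. -/
theorem QPDNonneg.integral_re_nonneg {ρ : QState n} {s : ℝ} (h : ρ.QPDNonneg s)
    (G : SchwartzMap (PhaseSpace n) ℂ) (hG : HasCompactSupport G)
    (hpos : ∀ w, ∃ t : ℝ, 0 ≤ t ∧ 𝓕⁻ (G : PhaseSpace n → ℂ) w = t) :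
    0 ≤ (∫ α, ρ.chiOrdered s α * G (phaseFreq α)).re := by
  -- The inverse transform of `G` is real and non-negative by `hpos`, so its real part is an
  -- admissible test function whose `phaseFourier` is a positive multiple of `G ∘ phaseFreq`.
  set φ : SchwartzMap (PhaseSpace n) ℝ := (𝓕⁻ G).postcompCLM (𝕜 := ℝ) Complex.reCLM with hφ
  have hφ1 : ∀ β, φ β = (𝓕⁻ (G : PhaseSpace n → ℂ) β).re := by
    intro β
    simp [hφ, SchwartzMap.fourierInv_coe]
  have hφ2 : (fun β => (φ β : ℂ)) = (𝓕⁻ G : SchwartzMap (PhaseSpace n) ℂ) := by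
    ext β
    obtain ⟨t, _, ht⟩ := hpos β
    rw [hφ1, SchwartzMap.fourierInv_coe, ht, Complex.ofReal_re]
  have hF : ∀ α, phaseFourier φ α = ((Real.pi ^ (2 * n))⁻¹ : ℝ) * G (phaseFreq α) := by
    intro α
    rw [phaseFourier_eq, hφ2, ← SchwartzMap.fourier_coe, FourierTransform.fourier_fourierInv_eq]
  have hcs : HasCompactSupport (phaseFourier φ) := by
    obtain ⟨R, hR⟩ := hG.isBounded.subset_closedBall 0
    refine HasCompactSupport.intro (isCompact_closedBall (0 : PhaseSpace n) (Real.pi * R))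
      fun α hα => ?_
    rw [hF, image_eq_zero_of_notMem_tsupport (f := (G : PhaseSpace n → ℂ)), mul_zero]
    intro hmem
    have := hR hmem
    rw [mem_closedBall_zero_iff, norm_phaseFreq] at this
    refine hα (mem_closedBall_zero_iff.2 ?_)
    rwa [inv_mul_le_iff₀ Real.pi_pos] at this
  have h0 := h φ hcs fun β => by
    obtain ⟨t, ht0, ht⟩ := hpos β
    rw [hφ1, ht]
    exact ht0
  rw [qpd] at h0
  simp_rw [hF, mul_left_comm] at h0
  rw [integral_const_mul, Complex.re_ofReal_mul] at h0
  exact nonneg_of_mul_nonneg_right h0 (by positivity)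

/-- For nonzero `z`, the choice `c = -conj z / |z|` gives `c z = -|z|`. -/
theorem norm_le_one_of_forall_unit {z : ℂ} (h : ∀ c : ℂ, ‖c‖ = 1 → 0 ≤ 1 + (c * z).re) :
    ‖z‖ ≤ 1 := by
  by_cases hz : z = 0
  · simp [hz]
  have hz' : (‖z‖ : ℂ) ≠ 0 := by simpa using hz
  have := h (-conj z / ‖z‖) (by
    rw [norm_div, norm_neg, RCLike.norm_conj, Complex.norm_real, norm_norm,
      div_self (norm_ne_zero_iff.2 hz)])
  have e : -conj z / ‖z‖ * z = ((-‖z‖ : ℝ) : ℂ) := by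
    rw [div_mul_eq_mul_div, neg_mul, Complex.conj_mul', div_eq_iff hz']
    push_cast
    ring
  rw [e, Complex.ofReal_re] at this
  linarith

/-- A state with `W_ρ(s, ·) ≥ 0` has `|χ_ρ(s, α)| ≤ 1`. -/
theorem QPDNonneg.norm_chiOrdered_le {ρ : QState n} {s : ℝ} (h : ρ.QPDNonneg s)
    (α₀ : PhaseSpace n) : ‖ρ.chiOrdered s α₀‖ ≤ 1 := by
  refine norm_le_one_of_forall_unit fun c hc => ?_
  have hχ := ρ.continuous_chiOrdered s
  -- Bochner's argument with the two points `0` and `α₀`: `p 0 = 2 (1 + Re(c χ_ρ(s, α₀)))` is the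
  -- quadratic form with coefficients of modulus one. Point evaluation is not an admissible test, so
  -- `p` is first averaged against kernels shrinking to the origin.
  set p : PhaseSpace n → ℝ := fun α => (2 * ρ.chiOrdered s α + c * ρ.chiOrdered s (α + α₀) +
    conj c * ρ.chiOrdered s (α - α₀)).re with hp
  have hpc : Continuous p := by
    refine Complex.continuous_re.comp ?_
    have h1 : Continuous fun α => ρ.chiOrdered s (α + α₀) := hχ.comp (by fun_prop)
    have h2 : Continuous fun α => ρ.chiOrdered s (α - α₀) := hχ.comp (by fun_prop)
    fun_prop
  have h0 : 0 ≤ p 0 := by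
    refine nonneg_of_integral_kernel_nonneg hpc fun r hr => ?_
    -- `phaseFreq` scales norms by `π⁻¹`, whence the radius.
    obtain ⟨B, K, hBK, hK0, hKn, hKs, hBF⟩ :=
      exists_schwartz_nonneg_fourier_nonneg (E := PhaseSpace n) (r := Real.pi⁻¹ * r) (by positivity)
    have hKc : Continuous K := by
      have : K = fun x => (B x).re := by ext x; rw [hBK, Complex.ofReal_re]
      rw [this]
      exact Complex.continuous_re.comp B.continuous
    have hks : ∀ α, K (phaseFreq α) ≠ 0 → ‖α‖ < r := by
      intro α hα
      have := hKs _ hα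
      rw [norm_phaseFreq] at this
      exact lt_of_mul_lt_mul_left this (by positivity)
    refine ⟨fun α => K (phaseFreq α), hKc.comp continuous_phaseFreq, fun _ => hK0 _, ?_, hks, ?_⟩
    · obtain ⟨w, hw⟩ := Function.ne_iff.1 hKn
      obtain ⟨α, rfl⟩ := surjective_phaseFreq w
      exact Function.ne_iff.2 ⟨α, hw⟩
    have hBcs : HasCompactSupport B := by
      refine HasCompactSupport.intro (isCompact_closedBall (0 : PhaseSpace n) (Real.pi⁻¹ * r))
        fun x hx => ?_
      by_contra hne
      rw [hBK, Complex.ofReal_eq_zero] at hne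
      exact hx (by simpa using (hKs x hne).le)
    -- The inverse transform of this combination of translates is that of `B` times `2 + 2 Re(c e^A)
    -- = |1 + c e^A|² ≥ 0`, with `A` imaginary.
    set G : SchwartzMap (PhaseSpace n) ℂ := (2 : ℂ) • B +
      c • SchwartzMap.compSubConstCLM ℂ (phaseFreq α₀) B +
      conj c • SchwartzMap.compSubConstCLM ℂ (-phaseFreq α₀) B with hG
    have hGx : ∀ x, G x = 2 * B x + c * B (x - phaseFreq α₀) + conj c * B (x + phaseFreq α₀) := by
      intro x
      simp [hG]
    have hGcs : HasCompactSupport G := by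
      have e1 : HasCompactSupport fun x => B (x - phaseFreq α₀) :=
        hBcs.comp_homeomorph (Homeomorph.subRight _)
      have e2 : HasCompactSupport fun x => B (x + phaseFreq α₀) :=
        hBcs.comp_homeomorph (Homeomorph.addRight _)
      have : (G : PhaseSpace n → ℂ) = (fun x => 2 * B x) + (fun x => c * B (x - phaseFreq α₀))
          + (fun x => conj c * B (x + phaseFreq α₀)) := by
        ext x
        exact hGx x
      rw [this]
      exact ((hBcs.mul_left).add e1.mul_left).add e2.mul_left
    have hmain := h.integral_re_nonneg G hGcs fun w => ?_
    · have hkcs : HasCompactSupport fun α => B (phaseFreq α) := by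
        refine HasCompactSupport.intro (isCompact_closedBall (0 : PhaseSpace n) r) fun x hx => ?_
        by_contra hne
        rw [hBK, Complex.ofReal_eq_zero] at hne
        exact hx (by simpa using (hks x hne).le)
      have hkc : Continuous fun α : PhaseSpace n => B (phaseFreq α) :=
        B.continuous.comp continuous_phaseFreq
      have i1 : Integrable fun α => ρ.chiOrdered s α * B (phaseFreq α) :=
        (hχ.mul hkc).integrable_of_hasCompactSupport hkcs.mul_left
      have i2 : Integrable fun α => ρ.chiOrdered s (α + α₀) * B (phaseFreq α) :=
        ((hχ.comp (by fun_prop : Continuous fun α => α + α₀)).mul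
          hkc).integrable_of_hasCompactSupport hkcs.mul_left
      have i3 : Integrable fun α => ρ.chiOrdered s (α - α₀) * B (phaseFreq α) :=
        ((hχ.comp (by fun_prop : Continuous fun α => α - α₀)).mul
          hkc).integrable_of_hasCompactSupport hkcs.mul_left
      have i2' : Integrable fun α => ρ.chiOrdered s α * B (phaseFreq α - phaseFreq α₀) := by
        simpa [phaseFreq_sub] using i2.comp_sub_right α₀
      have i3' : Integrable fun α => ρ.chiOrdered s α * B (phaseFreq α + phaseFreq α₀) := by
        simpa [phaseFreq_add] using i3.comp_add_right α₀
      -- A change of variables moves the translation from the kernel to `χ_ρ(s, ·)`, which produces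
      -- `p`.
      have e2 : ∫ α, ρ.chiOrdered s α * B (phaseFreq α - phaseFreq α₀)
          = ∫ α, ρ.chiOrdered s (α + α₀) * B (phaseFreq α) := by
        rw [← integral_sub_right_eq_self (fun α => ρ.chiOrdered s (α + α₀) * B (phaseFreq α)) α₀]
        simp [phaseFreq_sub]
      have e3 : ∫ α, ρ.chiOrdered s α * B (phaseFreq α + phaseFreq α₀)
          = ∫ α, ρ.chiOrdered s (α - α₀) * B (phaseFreq α) := by
        rw [← integral_add_right_eq_self (fun α => ρ.chiOrdered s (α - α₀) * B (phaseFreq α)) α₀]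
        simp [phaseFreq_add]
      have e : ∫ α, ρ.chiOrdered s α * G (phaseFreq α)
          = ∫ α, (2 * ρ.chiOrdered s α + c * ρ.chiOrdered s (α + α₀) +
              conj c * ρ.chiOrdered s (α - α₀)) * B (phaseFreq α) := by
        have l : ∀ α, ρ.chiOrdered s α * G (phaseFreq α)
            = 2 * (ρ.chiOrdered s α * B (phaseFreq α))
              + c * (ρ.chiOrdered s α * B (phaseFreq α - phaseFreq α₀))
              + conj c * (ρ.chiOrdered s α * B (phaseFreq α + phaseFreq α₀)) := by
          intro α; rw [hGx]; ring
        have l' : ∀ α, (2 * ρ.chiOrdered s α + c * ρ.chiOrdered s (α + α₀) +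
              conj c * ρ.chiOrdered s (α - α₀)) * B (phaseFreq α)
            = 2 * (ρ.chiOrdered s α * B (phaseFreq α))
              + c * (ρ.chiOrdered s (α + α₀) * B (phaseFreq α))
              + conj c * (ρ.chiOrdered s (α - α₀) * B (phaseFreq α)) := by
          intro α; ring
        simp_rw [l, l']
        rw [integral_linear_combination i1 i2' i3', integral_linear_combination i1 i2 i3, e2, e3]
      rw [e] at hmain
      have hint : Integrable fun α => (2 * ρ.chiOrdered s α + c * ρ.chiOrdered s (α + α₀) +
              conj c * ρ.chiOrdered s (α - α₀)) * B (phaseFreq α) := by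
        refine (((i1.const_mul 2).add (i2.const_mul c)).add (i3.const_mul (conj c))).congr
          (.of_forall fun α => ?_)
        simp only [Pi.add_apply]
        ring
      have hre := integral_re hint
      simp only [RCLike.re_to_complex] at hre
      rw [← hre] at hmain
      refine hmain.trans_eq (integral_congr_ae (.of_forall fun α => ?_))
      simp only [hp, hBK, Complex.re_mul_ofReal]
    · obtain ⟨t, ht0, ht⟩ := hBF (-w)
      refine ⟨t * (2 + 2 * (c * Complex.exp (((-(2 * Real.pi * inner ℝ (-w) (phaseFreq α₀)) : ℝ) : ℂ)
        * Complex.I)).re), mul_nonneg ht0 ?_, ?_⟩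
      · have := (abs_le.1 (Complex.abs_re_le_norm (c * Complex.exp
          (((-(2 * Real.pi * inner ℝ (-w) (phaseFreq α₀)) : ℝ) : ℂ) * Complex.I)))).1
        rw [norm_mul, hc, Complex.norm_exp_ofReal_mul_I] at this
        linarith
      · have f1 : ∀ a, 𝓕 (SchwartzMap.compSubConstCLM ℂ a B : PhaseSpace n → ℂ) (-w)
            = Complex.exp (((-(2 * Real.pi * inner ℝ (-w) a) : ℝ) : ℂ) * Complex.I) * t := by
          intro a
          rw [← ht, ← fourier_comp_sub]
          rfl
        have f2 : 𝓕 (G : PhaseSpace n → ℂ) (-w) = 2 * 𝓕 (B : PhaseSpace n → ℂ) (-w)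
            + c * 𝓕 (SchwartzMap.compSubConstCLM ℂ (phaseFreq α₀) B : PhaseSpace n → ℂ) (-w)
            + conj c * 𝓕 (SchwartzMap.compSubConstCLM ℂ (-phaseFreq α₀) B : PhaseSpace n → ℂ) (-w)
            := by
          simp only [← SchwartzMap.fourier_coe, hG, FourierTransform.fourier_add,
            FourierTransform.fourier_smul]
          rfl
        rw [Real.fourierInv_eq_fourier_neg, f2, f1, f1, ht]
        set A := ((-(2 * Real.pi * inner ℝ (-w) (phaseFreq α₀)) : ℝ) : ℂ) * Complex.I with hA
        have hA' : ((-(2 * Real.pi * inner ℝ (-w) (-phaseFreq α₀)) : ℝ) : ℂ) * Complex.I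
            = conj A := by
          rw [hA, map_mul, Complex.conj_ofReal, Complex.conj_I, inner_neg_right]
          push_cast
          ring
        rw [hA', Complex.exp_conj]
        have := Complex.add_conj (c * Complex.exp A)
        rw [map_mul] at this
        push_cast at this ⊢
        linear_combination (t : ℂ) * this
  have hp0 : p 0 = 2 * (1 + (c * ρ.chiOrdered s α₀).re) := by
    have : 2 * ρ.chiOrdered s 0 + c * ρ.chiOrdered s (0 + α₀) + conj c * ρ.chiOrdered s (0 - α₀)
        = ((2 * (1 + (c * ρ.chiOrdered s α₀).re) : ℝ) : ℂ) := by
      rw [zero_add, zero_sub, chiOrdered_neg, chiOrdered_zero]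
      have := Complex.add_conj (c * ρ.chiOrdered s α₀)
      rw [map_mul] at this
      push_cast at this ⊢
      linear_combination this
    rw [hp]
    simp only [this, Complex.ofReal_re]
  linarith

theorem QPDNonneg.norm_chi_le {ρ : QState n} {s : ℝ} (h : ρ.QPDNonneg s) (α : PhaseSpace n) :
    ‖ρ.chi α‖ ≤ Real.exp (-s * ‖α‖ ^ 2 / 2) := by
  have := h.norm_chiOrdered_le α
  rw [chiOrdered, norm_mul, Complex.norm_real, Real.norm_of_nonneg (Real.exp_pos _).le] at this
  rw [show -s * ‖α‖ ^ 2 / 2 = -(s * ‖α‖ ^ 2 / 2) by ring, Real.exp_neg]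
  rwa [← one_div, le_div_iff₀' (Real.exp_pos _)]

/-- Attainment of the supremum is not needed: the bound holds for each `t < s`, through an
admissible `u > t`, and passes to the limit `t → s`. -/
theorem norm_chi_le_of_le_classicality {ρ : QState n} {s : ℝ} (hs : 0 < s)
    (h : s ≤ ρ.classicality) (α : PhaseSpace n) : ‖ρ.chi α‖ ≤ Real.exp (-s * ‖α‖ ^ 2 / 2) := by
  -- The supremum of the empty set is 0 by convention, which `0 < s` excludes.
  have hne : {s : ℝ | s ∈ Set.Icc (-1) 1 ∧ ρ.QPDNonneg s}.Nonempty := by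
    by_contra hem
    rw [Set.not_nonempty_iff_eq_empty] at hem
    rw [classicality, hem, Real.sSup_empty] at h
    linarith
  have hlt : ∀ t < s, ‖ρ.chi α‖ ≤ Real.exp (-t * ‖α‖ ^ 2 / 2) := by
    intro t ht
    obtain ⟨u, hu, htu⟩ := exists_lt_of_lt_csSup hne (ht.trans_le h)
    refine (hu.2.norm_chi_le α).trans (Real.exp_le_exp.2 ?_)
    nlinarith [sq_nonneg ‖α‖]
  have hcont : Continuous fun t : ℝ => Real.exp (-t * ‖α‖ ^ 2 / 2) := by fun_prop
  exact ge_of_tendsto (hcont.continuousWithinAt (s := Set.Iio s) (x := s))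
    (Filter.eventually_of_mem self_mem_nhdsWithin hlt)

end QState

end

open ProbabilityTheory

/-! ### Hoeffding's inequality for bounded real and complex samples -/

section Hoeffding

variable {X : Type*} [MeasurableSpace X] (μ : Measure X) [IsProbabilityMeasure μ]

/-- Hoeffding's inequality for independent samples of a function with values in `[-1, 1]`. -/
theorem pi_real_sum_sub_integral_ge_le {f : X → ℝ} (hf : Measurable f) (hf1 : ∀ x, |f x| ≤ 1)
    (N : ℕ) {t : ℝ} (ht : 0 ≤ t) :
    (Measure.pi fun _ : Fin N => μ).real {ζ | N * t ≤ ∑ j, (f (ζ j) - ∫ x, f x ∂μ)}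
      ≤ Real.exp (-N * t ^ 2 / 2) := by
  have hindep : iIndepFun (fun (j : Fin N) (ζ : Fin N → X) => f (ζ j) - ∫ x, f x ∂μ)
      (Measure.pi fun _ : Fin N => μ) :=
    iIndepFun_pi (μ := fun _ : Fin N => μ) (X := fun _ x => f x - ∫ x, f x ∂μ)
      fun _ => (hf.sub_const _).aemeasurable
  have hsub : ∀ j ∈ (Finset.univ : Finset (Fin N)),
      HasSubgaussianMGF (fun ζ : Fin N → X => f (ζ j) - ∫ x, f x ∂μ) 1
        (Measure.pi fun _ : Fin N => μ) := by
    intro j _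
    have hmp := measurePreserving_eval (fun _ : Fin N => μ) j
    have h := hasSubgaussianMGF_of_mem_Icc (X := fun ζ : Fin N → X => f (ζ j)) (a := -1) (b := 1)
      (μ := Measure.pi fun _ : Fin N => μ) (hf.comp (measurable_pi_apply j)).aemeasurable
      (.of_forall fun ζ => abs_le.1 (hf1 _))
    have hint : ∫ ζ, f (ζ j) ∂(Measure.pi fun _ : Fin N => μ) = ∫ x, f x ∂μ := by
      conv_rhs =>
        rw [← hmp.map_eq,
          integral_map hmp.measurable.aemeasurable hf.aestronglyMeasurable]
    rw [hint] at h
    -- The variance proxy of a variable in `[-1, 1]` is `((1 - (-1)) / 2)² = 1`.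
    convert h using 1
    rw [← NNReal.coe_inj]
    norm_num
  refine (HasSubgaussianMGF.measure_sum_ge_le_of_iIndepFun hindep hsub (by positivity)).trans_eq ?_
  congr 1
  rcases Nat.eq_zero_or_pos N with rfl | hN
  · simp
  · have : (N : ℝ) ≠ 0 := by positivity
    simp only [Finset.sum_const, Finset.card_univ, Fintype.card_fin, nsmul_eq_mul, mul_one,
      NNReal.coe_natCast]
    field_simp

/-- Hoeffding's inequality for independent samples of a function with values in the unit disc. -/
theorem pi_real_norm_mean_sub_integral_gt_le {f : X → ℂ} (hf : Measurable f)
    (hf1 : ∀ x, ‖f x‖ ≤ 1) {N : ℕ} (hN : 0 < N) {t : ℝ} (ht : 0 ≤ t) :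
    (Measure.pi fun _ : Fin N => μ).real
      {ζ | t < ‖(N : ℂ)⁻¹ * ∑ j, f (ζ j) - ∫ x, f x ∂μ‖} ≤ 4 * Real.exp (-N * t ^ 2 / 4) := by
  have hfi : Integrable f μ := .of_bound hf.aestronglyMeasurable 1 (.of_forall hf1)
  -- If `|z| > t`, one of `±Re z`, `±Im z` is at least `t / √2`. The four directions `c = ±1, ±i`
  -- give the prefactor 4, and `√2` turns the exponent `N t²/2` into `N t²/4`.
  set S : ℂ → Set (Fin N → X) := fun c =>
    {ζ | N * (t / √2) ≤ ∑ j, ((c * f (ζ j)).re - ∫ x, (c * f x).re ∂μ)} with hS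
  have hSc : ∀ c : ℂ, ‖c‖ = 1 →
      (Measure.pi fun _ : Fin N => μ).real (S c) ≤ Real.exp (-N * t ^ 2 / 4) := by
    intro c hc
    refine (pi_real_sum_sub_integral_ge_le μ (f := fun x => (c * f x).re)
      (Complex.measurable_re.comp (hf.const_mul c)) (fun x => ?_) N (by positivity)).trans_eq ?_
    · refine (Complex.abs_re_le_norm _).trans ?_
      rw [norm_mul, hc, one_mul]
      exact hf1 x
    · rw [div_pow, Real.sq_sqrt zero_le_two]
      ring_nf
  have hmem : ∀ (ζ : Fin N → X) (c : ℂ),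
      t / √2 ≤ (c * ((N : ℂ)⁻¹ * ∑ j, f (ζ j) - ∫ x, f x ∂μ)).re → ζ ∈ S c := by
    intro ζ c h
    have hNR : (0 : ℝ) < N := by exact_mod_cast hN
    have e : ∑ j, ((c * f (ζ j)).re - ∫ x, (c * f x).re ∂μ)
        = N * (c * ((N : ℂ)⁻¹ * ∑ j, f (ζ j) - ∫ x, f x ∂μ)).re := by
      have hre : ∫ x, (c * f x).re ∂μ = (c * ∫ x, f x ∂μ).re := by
        rw [← integral_const_mul]
        exact integral_re (hfi.const_mul c)
      have hNC : (N : ℂ) ≠ 0 := by exact_mod_cast hN.ne'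
      rw [Finset.sum_sub_distrib, hre, ← Complex.re_sum, ← Finset.mul_sum, Finset.sum_const,
        Finset.card_univ, Fintype.card_fin, nsmul_eq_mul, ← Complex.ofReal_natCast,
        ← Complex.re_ofReal_mul, ← Complex.re_ofReal_mul, ← Complex.sub_re]
      congr 1
      push_cast
      field_simp
    rw [hS, Set.mem_ofPred_eq, e]
    exact mul_le_mul_of_nonneg_left h hNR.le
  have hsub : {ζ : Fin N → X | t < ‖(N : ℂ)⁻¹ * ∑ j, f (ζ j) - ∫ x, f x ∂μ‖}
      ⊆ (S 1 ∪ S (-1)) ∪ (S Complex.I ∪ S (-Complex.I)) := by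
    intro ζ hζ
    by_contra hcon
    simp only [Set.mem_union, not_or] at hcon
    obtain ⟨⟨h1, h2⟩, h3, h4⟩ := hcon
    replace h1 := fun h => h1 (hmem ζ _ h)
    replace h2 := fun h => h2 (hmem ζ _ h)
    replace h3 := fun h => h3 (hmem ζ _ h)
    replace h4 := fun h => h4 (hmem ζ _ h)
    rw [Set.mem_ofPred_eq] at hζ
    set z := (N : ℂ)⁻¹ * ∑ j, f (ζ j) - ∫ x, f x ∂μ
    simp only [one_mul, neg_mul, Complex.neg_re, Complex.I_mul_re, neg_neg, not_le, imp_false]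
      at h1 h2 h3 h4
    have hu : (t / √2) ^ 2 = t ^ 2 / 2 := by rw [div_pow, Real.sq_sqrt zero_le_two]
    have hz : ‖z‖ ^ 2 = z.re ^ 2 + z.im ^ 2 := by
      rw [← Complex.normSq_eq_norm_sq, Complex.normSq_apply]
      ring
    have hre : z.re ^ 2 ≤ (t / √2) ^ 2 := sq_le_sq' (by linarith) h1.le
    have him : z.im ^ 2 ≤ (t / √2) ^ 2 := sq_le_sq' (by linarith) h4.le
    nlinarith
  refine (measureReal_mono hsub).trans ((measureReal_union_le _ _).trans ?_)
  have a1 := measureReal_union_le (μ := Measure.pi fun _ : Fin N => μ) (S 1) (S (-1))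
  have a2 := measureReal_union_le (μ := Measure.pi fun _ : Fin N => μ) (S Complex.I) (S (-Complex.I))
  have b1 := hSc 1 (by simp)
  have b2 := hSc (-1) (by simp)
  have b3 := hSc Complex.I (by simp)
  have b4 := hSc (-Complex.I) (by simp)
  linarith

end Hoeffding

/-! ### Guarantee of the heterodyne scheme -/

variable {n : ℕ}

/-- The failure probability of the heterodyne scheme at one query point inside the truncation
radius. -/
theorem heterodyne_failure_le (ρ : QState n) {N : ℕ} (hN : 0 < N) {ε s : ℝ} (hε : 0 < ε)
    {α : PhaseSpace n} (hα : ‖α‖ ^ 2 ≤ truncRadius ε s) :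
    (Measure.pi fun _ : Fin N => ρ.heterodyneLaw).real
      {ζ | ε < ‖heterodyneEstimate ε s ζ α - ρ.chi α‖}
      ≤ 4 * Real.exp (-N * (ε * Real.exp (-‖α‖ ^ 2 / 2)) ^ 2 / 4) := by
  -- Accuracy `ε` after multiplication by `e^{|α|²/2}` means accuracy `ε e^{-|α|²/2}` for the
  -- empirical mean.
  have h := pi_real_norm_mean_sub_integral_gt_le ρ.heterodyneLaw
    (f := fun ζ => Complex.exp (inner ℂ ζ α - inner ℂ α ζ))
    (Continuous.measurable (by fun_prop)) (fun ζ => (QState.norm_exp_inner_sub ζ α).le) hN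
    (t := ε * Real.exp (-‖α‖ ^ 2 / 2)) (by positivity)
  refine le_trans (measureReal_mono fun ζ hζ => ?_) h
  rw [Set.mem_ofPred_eq, heterodyneEstimate, if_pos hα, ρ.chi_eq, ← mul_sub, norm_mul,
    Complex.norm_real, Real.norm_of_nonneg (Real.exp_pos _).le] at hζ
  rw [Set.mem_ofPred_eq, neg_div, Real.exp_neg, ← div_eq_mul_inv, div_lt_iff₀' (Real.exp_pos _)]
  exact hζ

/-- The guarantee of the heterodyne scheme for a state with a Gaussian bound on `χ_ρ`. -/
theorem one_sub_le_heterodyneSuccess (ρ : QState n) {M N : ℕ} {ε δ s R : ℝ} (hε : 0 < ε)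
    (hδ : 0 < δ) (hs : 0 < s) (hM : 0 < M) (hN : 0 < N)
    (hdecay : ∀ α, ‖ρ.chi α‖ ≤ Real.exp (-s * ‖α‖ ^ 2 / 2)) (α : Fin M → PhaseSpace n)
    (hR : ∀ i, ‖α i‖ ^ 2 ≤ truncRadius ε s → ‖α i‖ ^ 2 ≤ R)
    (hNle : 4 * (ε ^ (-2 : ℝ) * Real.exp R * Real.log (4 * M / δ)) ≤ N) :
    1 - δ ≤ heterodyneSuccess ρ N ε s α := by
  set P := Measure.pi fun _ : Fin N => ρ.heterodyneLaw
  set F : Fin M → Set (Fin N → PhaseSpace n) := fun i =>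
    {ζ | ε < ‖heterodyneEstimate ε s ζ (α i) - ρ.chi (α i)‖} with hF
  have hMR : (0 : ℝ) < M := by exact_mod_cast hM
  have hFi : ∀ i, P.real (F i) ≤ δ / M := by
    intro i
    by_cases hi : ‖α i‖ ^ 2 ≤ truncRadius ε s
    · refine (heterodyne_failure_le ρ hN hε hi).trans ?_
      have h1 : Real.log (4 * M / δ) ≤ N * (ε * Real.exp (-‖α i‖ ^ 2 / 2)) ^ 2 / 4 := by
        have e1 : ε ^ (-2 : ℝ) * ε ^ 2 = 1 := by
          rw [← Real.rpow_natCast ε 2, ← Real.rpow_add hε]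
          norm_num
        have e2 : Real.exp R * Real.exp (-‖α i‖ ^ 2 / 2) ^ 2 = Real.exp (R - ‖α i‖ ^ 2) := by
          rw [← Real.exp_nat_mul, ← Real.exp_add]
          congr 1
          push_cast
          ring
        have e3 : 1 ≤ Real.exp (R - ‖α i‖ ^ 2) := Real.one_le_exp (by linarith [hR i hi])
        by_cases hlog : Real.log (4 * M / δ) ≤ 0
        · exact hlog.trans (by positivity)
        push Not at hlog
        calc Real.log (4 * M / δ) ≤ Real.exp (R - ‖α i‖ ^ 2) * Real.log (4 * M / δ) :=
              le_mul_of_one_le_left hlog.le e3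
          _ = 4 * (ε ^ (-2 : ℝ) * Real.exp R * Real.log (4 * M / δ)) *
                (ε * Real.exp (-‖α i‖ ^ 2 / 2)) ^ 2 / 4 := by
              rw [← e2]
              linear_combination (-(Real.exp R * Real.exp (-‖α i‖ ^ 2 / 2) ^ 2
                * Real.log (4 * M / δ))) * e1
          _ ≤ _ := by gcongr
      have h2 : Real.exp (-N * (ε * Real.exp (-‖α i‖ ^ 2 / 2)) ^ 2 / 4) ≤ δ / (4 * M) := by
        rw [← Real.exp_log (show 0 < δ / (4 * M) by positivity), Real.exp_le_exp,
          ← inv_div (4 * (M : ℝ)) δ, Real.log_inv]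
        linarith
      calc _ ≤ 4 * (δ / (4 * M)) := by gcongr
        _ = δ / M := by field_simp
    -- Beyond the truncation radius the answer is 0 and the decay gives `|χ_ρ(α i)| ≤ ε`, so failure
    -- is impossible.
    · have : F i = ∅ := by
        refine Set.eq_empty_of_forall_notMem fun ζ hζ => ?_
        rw [hF, Set.mem_ofPred_eq, heterodyneEstimate, if_neg hi, zero_sub, norm_neg] at hζ
        refine absurd ((hdecay (α i)).trans ?_) (not_le.2 hζ)
        rw [truncRadius, not_le, Real.log_inv, div_mul_eq_mul_div, div_lt_iff₀ hs] at hi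
        rw [← Real.le_log_iff_exp_le hε]
        linarith
      rw [this, measureReal_empty]
      positivity
  -- Covering the whole space by success and failures uses only subadditivity, so the success event
  -- need not be shown measurable.
  have hcover : (Set.univ : Set (Fin N → PhaseSpace n))
      ⊆ {ζ | ∀ i, ‖heterodyneEstimate ε s ζ (α i) - ρ.chi (α i)‖ ≤ ε} ∪ ⋃ i, F i := by
    intro ζ _
    by_cases h : ∀ i, ‖heterodyneEstimate ε s ζ (α i) - ρ.chi (α i)‖ ≤ ε
    · exact Or.inl h
    · push Not at h
      exact Or.inr (Set.mem_iUnion.2 h)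
  have h1 : 1 ≤ heterodyneSuccess ρ N ε s α + P.real (⋃ i, F i) := by
    have := (measureReal_mono (μ := P) hcover).trans (measureReal_union_le _ _)
    rwa [probReal_univ] at this
  have h2 : P.real (⋃ i, F i) ≤ δ := by
    refine (measureReal_iUnion_fintype_le _).trans ((Finset.sum_le_sum fun i _ => hFi i).trans_eq ?_)
    rw [Finset.sum_const, Finset.card_univ, Fintype.card_fin, nsmul_eq_mul]
    field_simp
  linarith

/-- Since `e^L = ε^{-2/s}`, capping `|α|²` at the truncation radius turns the cost `ε⁻² e^{|α|²}`
into a power of `ε`. -/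
theorem exp_truncRadius {ε : ℝ} (hε : 0 < ε) (s : ℝ) :
    ε ^ (-2 : ℝ) * Real.exp (truncRadius ε s) = ε ^ (-2 * (1 + 1 / s)) := by
  rw [show -2 * (1 + 1 / s) = -2 + -(2 / s) by ring, Real.rpow_add hε, truncRadius,
    Real.rpow_def_of_pos hε (-(2 / s)), Real.log_inv]
  ring_nf

end CVLearning

end

/-! ### The main theorem -/

theorem mainTheorem7 (c : ℝ) (hc : 1 < c) :
    ∃ C : ℝ, 0 < C ∧
      ∀ (n M : ℕ) (ε δ κ : ℝ), 0 < ε → ε < 1 → 0 < δ → δ < 1 → 0 < κ → c * δ ≤ M →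
      ∀ (ρ : CVLearning.QState n) (α : Fin M → CVLearning.PhaseSpace n),
        (∀ i, ‖α i‖ ^ 2 ≤ κ * n) →
        IsProbabilityMeasure ρ.heterodyneLaw ∧
        (∀ s : ℝ, 0 < s → s ≤ 1 → s ≤ ρ.classicality →
          (κ * n ≤ CVLearning.truncRadius ε s →
            ∀ N : ℕ, C * (ε ^ (-2 : ℝ) * Real.exp (κ * n) * Real.log (M / δ)) ≤ N →
              1 - δ ≤ CVLearning.heterodyneSuccess ρ N ε s α) ∧
          (CVLearning.truncRadius ε s ≤ κ * n →
            ∀ N : ℕ, C * (ε ^ (-2 * (1 + 1 / s)) * Real.log (M / δ)) ≤ N →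
              1 - δ ≤ CVLearning.heterodyneSuccess ρ N ε s α)) ∧
        (ρ.IsClassical →
          ∀ N : ℕ, C * (ε ^ (-4 : ℝ) * Real.log (M / δ)) ≤ N →
            1 - δ ≤ CVLearning.heterodyneSuccess ρ N ε 1 α) := by
  have hlc : 0 < Real.log c := Real.log_pos hc
  have hl4 : 0 < Real.log 4 := Real.log_pos (by norm_num)
  -- The outer 4 is from the Hoeffding exponent. The bracket absorbs the `log 4` of its prefactor,
  -- because `log (M / δ) ≥ log c > 0`.
  refine ⟨4 * (1 + Real.log 4 / Real.log c), by positivity, ?_⟩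
  intro n M ε δ κ hε _ hδ _ _ hM ρ α hα
  have hMR : (0 : ℝ) < M := lt_of_lt_of_le (by positivity) hM
  have hM0 : 0 < M := by exact_mod_cast hMR
  have hlog : Real.log c ≤ Real.log (M / δ) :=
    Real.log_le_log (by linarith) ((le_div_iff₀ hδ).2 hM)
  have hlog4 : Real.log (4 * M / δ) ≤ (1 + Real.log 4 / Real.log c) * Real.log (M / δ) := by
    rw [mul_div_assoc, Real.log_mul (by norm_num) (by positivity), add_mul, one_mul, add_comm]
    gcongr
    rw [div_mul_eq_mul_div, le_div_iff₀ hlc]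
    gcongr
  -- `R` bounds `|α i|²` over the queries inside the truncation radius: it is `κ n` in the first
  -- regime and the truncation radius itself in the other two.
  have key : ∀ s R : ℝ, 0 < s →
      (∀ β, ‖ρ.chi β‖ ≤ Real.exp (-s * ‖β‖ ^ 2 / 2)) →
      (∀ i, ‖α i‖ ^ 2 ≤ CVLearning.truncRadius ε s → ‖α i‖ ^ 2 ≤ R) →
      ∀ N : ℕ, 4 * (1 + Real.log 4 / Real.log c) *
        (ε ^ (-2 : ℝ) * Real.exp R * Real.log (M / δ)) ≤ N →
      1 - δ ≤ CVLearning.heterodyneSuccess ρ N ε s α := by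
    intro s R hs hdecay hR N hN
    have hl : 0 < Real.log (M / δ) := hlc.trans_le hlog
    have hNR : (0 : ℝ) < N := lt_of_lt_of_le (by positivity) hN
    refine CVLearning.one_sub_le_heterodyneSuccess ρ hε hδ hs hM0 (by exact_mod_cast hNR) hdecay α
      hR (le_trans ?_ hN)
    calc 4 * (ε ^ (-2 : ℝ) * Real.exp R * Real.log (4 * M / δ))
        ≤ 4 * (ε ^ (-2 : ℝ) * Real.exp R *
            ((1 + Real.log 4 / Real.log c) * Real.log (M / δ))) := by gcongr
      _ = _ := by ring
  refine ⟨inferInstance, fun s hs _ hsc => ⟨fun _ => ?_, fun _ N hN => ?_⟩, fun hcl N hN => ?_⟩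
  · exact key s _ hs (CVLearning.QState.norm_chi_le_of_le_classicality hs hsc) fun i _ => hα i
  · rw [← CVLearning.exp_truncRadius hε] at hN
    exact key s _ hs (CVLearning.QState.norm_chi_le_of_le_classicality hs hsc) (fun i h => h) N hN
  · rw [show (-4 : ℝ) = -2 * (1 + 1 / 1) by norm_num, ← CVLearning.exp_truncRadius hε] at hN
    exact key 1 _ one_pos (CVLearning.QState.QPDNonneg.norm_chi_le hcl) (fun i h => h) N hN
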